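/- Let $n\ge 0$ and let $H(s)$ be an $n\times n$ matrix of real rational functions in $\mathcal{RH}_\infty$ (every entry is proper and has no pole with $\operatorname{Re} s\ge 0$); put $H(j\infty):=\lim_{\omega\to\infty}H(j\omega)$. For a complex $n\times n$ matrix $A$ let $$\operatorname{SRG}(A)=\Big\{\tfrac{\|y\|}{\|u\|}\exp\big(\pm j\,\angle(u,y)\big)\;:\; u\in\mathbb{C}^n,\ \|u\|=1,\ y=Au\Big\},\qquad \angle(u,y)=\arccos\frac{\operatorname{Re}\langle y,u\rangle}{\|y\|\|u\|}$$ (with $\angle(u,y)=0$ if $y=0$). Suppose that for every $\omega\in[0,\infty]$ and every $\tau\in(0,1]$, $$-1\notin\tau\operatorname{SRG}(H(j\omega)).$$ Then the unity negative feedback loop $e=u-y$, $y=He$ is $\mathcal{L}_2$-stable, for signals with values in $F^n$ with $F=\mathbb{R}$ or $F=\mathbb{C}$. Here $y=He$ means that $y$ is the response to $e$, from the zero initial state, of a state-space system $\dot x=Ax+Be$, $y=Cx+De$ with real matrices and transfer function $H(s)=C(sI-A)^{-1}B+D$; signals are functions on $[0,\infty)$ and are identified when they agree almost everywhere. $\mathcal{L}_2$-stability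 means that for every $u$ that is square integrable on each bounded interval $[0,T]$ the loop has exactly one output $y$ with the same property, and that there is a constant $\gamma$ such that every $u\in\mathcal{L}_2$ yields $y\in\mathcal{L}_2$ with $\|y\|\le\gamma\|u\|$. -/

import Mathlib

open scoped Pointwise

noncomputable section

namespace SRGFeedback

/-! ### Signals on the time axis `[0, ∞)` -/

/-- A (vector valued) signal. Only its values at times `t ≥ 0` matter. -/
abbrev Signal (𝕜 : Type*) (n : ℕ) := ℝ → EuclideanSpace 𝕜 (Fin n)

/-- Lebesgue measure on the time axis `[0, ∞)`. -/
abbrev timeMeasure : MeasureTheory.Measure ℝ :=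
  MeasureTheory.volume.restrict (Set.Ici (0 : ℝ))

/-- The space of square integrable signals on `[0, ∞)`. -/
def MemL2 {𝕜 : Type*} [RCLike 𝕜] {n : ℕ} (u : Signal 𝕜 n) : Prop :=
  MeasureTheory.MemLp u 2 timeMeasure

/-- The extended space: signals that are square integrable on every bounded interval `[0, T]`. -/
def MemL2e {𝕜 : Type*} [RCLike 𝕜] {n : ℕ} (u : Signal 𝕜 n) : Prop :=
  ∀ T : ℝ, MeasureTheory.MemLp u 2 (MeasureTheory.volume.restrict (Set.Icc (0 : ℝ) T))

/-- The norm of a signal, `(∫₀^∞ ‖u(t)‖² dt)^{1/2}`, with values in `[0, ∞]`. -/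
def l2norm {𝕜 : Type*} [RCLike 𝕜] {n : ℕ} (u : Signal 𝕜 n) : ENNReal :=
  MeasureTheory.eLpNorm u 2 timeMeasure

/-! ### State space systems and transfer functions -/

/-- A system `x' = A x + B u`, `y = C x + D u` with real matrices, `m` inputs, `p` outputs and
state dimension `N`. -/
structure StateSpace (N m p : ℕ) where
  A : Matrix (Fin N) (Fin N) ℝ
  B : Matrix (Fin N) (Fin m) ℝ
  C : Matrix (Fin p) (Fin N) ℝ
  D : Matrix (Fin p) (Fin m) ℝ

/-- The transfer function `C (s I - A)⁻¹ B + D`, a matrix of real rational functions of `s`. The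
matrix `s I - A` is invertible over the field of rational functions. -/
def StateSpace.transferFunction {N m p : ℕ} (S : StateSpace N m p) :
    Matrix (Fin p) (Fin m) (RatFunc ℝ) :=
  S.C.map RatFunc.C * (Matrix.scalar (Fin N) RatFunc.X - S.A.map RatFunc.C)⁻¹ *
    S.B.map RatFunc.C + S.D.map RatFunc.C

/-- A real matrix acting on vectors over `𝕜`, where `𝕜` is `ℝ` or `ℂ`. -/
def act {𝕜 : Type*} [RCLike 𝕜] {p m : ℕ} (M : Matrix (Fin p) (Fin m) ℝ)
    (v : EuclideanSpace 𝕜 (Fin m)) : EuclideanSpace 𝕜 (Fin p) :=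
  WithLp.toLp 2 (Matrix.mulVec (M.map (algebraMap ℝ 𝕜)) v.ofLp)

/-- `y` is the response of the system to the input `u` from the initial state `x(0) = 0`. The
differential equation is understood in integrated form (`x` is absolutely continuous and
`x' = A x + B u` almost everywhere). -/
def StateSpace.IsResponse {𝕜 : Type*} [RCLike 𝕜] {N m p : ℕ} (S : StateSpace N m p)
    (u : Signal 𝕜 m) (y : Signal 𝕜 p) : Prop :=
  MemL2e u ∧
  ∃ x : Signal 𝕜 N, ContinuousOn x (Set.Ici 0) ∧
    (∀ t : ℝ, 0 ≤ t → x t = ∫ s in (0 : ℝ)..t, (act S.A (x s) + act S.B (u s))) ∧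
    ∀ᵐ t ∂timeMeasure, y t = act S.C (x t) + act S.D (u t)

/-- The input-output behaviour of the LTI system with transfer function `H`: `y` is the zero-state
response to `u` of a state space system with transfer function `H`. -/
def IsLTIResponse {𝕜 : Type*} [RCLike 𝕜] {m p : ℕ} (H : Matrix (Fin p) (Fin m) (RatFunc ℝ))
    (u : Signal 𝕜 m) (y : Signal 𝕜 p) : Prop :=
  ∃ (N : ℕ) (S : StateSpace N m p), S.transferFunction = H ∧ S.IsResponse u y

/-- The space `RH∞`: matrices of real rational functions that are proper and have no pole in the
closed right half plane. -/
def IsRHInf {m p : ℕ} (H : Matrix (Fin p) (Fin m) (RatFunc ℝ)) : Prop :=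
  ∀ i j, (H i j).num.natDegree ≤ (H i j).denom.natDegree ∧
    ∀ s : ℂ, 0 ≤ s.re → Polynomial.aeval s (H i j).denom ≠ 0

/-- The value `H(s)` at a complex number `s` that is not a pole. -/
def evalAt {m p : ℕ} (H : Matrix (Fin p) (Fin m) (RatFunc ℝ)) (s : ℂ) :
    Matrix (Fin p) (Fin m) ℂ :=
  H.map (RatFunc.eval (algebraMap ℝ ℂ) s)

/-- The value `H(∞) = lim_{ω → ∞} H(jω)` of a proper `H`: entry by entry, the quotient of the
coefficients of numerator and denominator at the degree of the denominator. -/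
def evalInfty {m p : ℕ} (H : Matrix (Fin p) (Fin m) (RatFunc ℝ)) : Matrix (Fin p) (Fin m) ℂ :=
  H.map fun r => ((r.num.coeff r.denom.natDegree / r.denom.leadingCoeff : ℝ) : ℂ)

/-! ### Scaled relative graphs of square matrices -/

/-- The angle between two vectors of `ℂⁿ`, set to `0` if one of them vanishes. -/
def vecAngle {n : ℕ} (u y : EuclideanSpace ℂ (Fin n)) : ℝ :=
  open Classical in
  if u = 0 ∨ y = 0 then 0 else Real.arccos ((inner ℂ y u).re / (‖y‖ * ‖u‖))

/-- The scaled relative graph of a complex square matrix: the points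
`(‖y‖ / ‖u‖) exp(± j ∠(u, y))` with `‖u‖ = 1` and `y = A u`. -/
def SRG {n : ℕ} (A : Matrix (Fin n) (Fin n) ℂ) : Set ℂ :=
  {z | ∃ u y : EuclideanSpace ℂ (Fin n), ‖u‖ = 1 ∧ y = WithLp.toLp 2 (A.mulVec u.ofLp) ∧
    (z = ((‖y‖ / ‖u‖ : ℝ) : ℂ) * Complex.exp (Complex.I * (vecAngle u y : ℂ)) ∨
      z = ((‖y‖ / ‖u‖ : ℝ) : ℂ) * Complex.exp (-(Complex.I * (vecAngle u y : ℂ))))}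

/-! ### The unity negative feedback loop and its stability -/

/-- The loop `e = u - y`, `y = H e`, as a relation between the external input `u` and the
output `y`. -/
def UnityFeedback {𝕜 : Type*} [RCLike 𝕜] {n : ℕ} (H : Matrix (Fin n) (Fin n) (RatFunc ℝ))
    (u y : Signal 𝕜 n) : Prop :=
  IsLTIResponse H (fun t => u t - y t) y

/-- A system, given as a relation between inputs and outputs, is `L2`-stable if it defines an
operator on the extended space (every input has an output, unique almost everywhere) that maps
square integrable inputs to square integrable outputs with a finite gain. -/
def IsL2Stable {𝕜 : Type*} [RCLike 𝕜] {m p : ℕ} (R : Signal 𝕜 m → Signal 𝕜 p → Prop) : Prop :=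
  (∀ u : Signal 𝕜 m, MemL2e u → ∃ y : Signal 𝕜 p, MemL2e y ∧ R u y) ∧
  (∀ (u : Signal 𝕜 m) (y y' : Signal 𝕜 p), MemL2e u → R u y → R u y' → y =ᵐ[timeMeasure] y') ∧
  ∃ γ : NNReal, ∀ (u : Signal 𝕜 m) (y : Signal 𝕜 p), MemL2 u → R u y →
    MemL2 y ∧ l2norm y ≤ γ * l2norm u

end SRGFeedback

end

open scoped Pointwise

noncomputable section

namespace SRGFeedback

section

open MeasureTheory Set

/-! ### Linear differential equations in integrated form -/

section IntegralSolution

variable {E F : Type*} [NormedAddCommGroup E] [NormedAddCommGroup F]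

/-! The graphical condition enters only through eigenvectors. If `w ≠ 0` and `w + τ A w = 0` with `τ
> 0`, then `A w` is antiparallel to `w`, the angle is `π`, and `-1/τ` lies in the scaled relative
graph of `A` (`neg_one_mem_smul_SRG`). The hypothesis thus makes `I + τ H(jω)` nonsingular for all
`ω ∈ [0, ∞]` and `τ ∈ (0, 1]`, and a homotopy in `τ` turns this into stability at `τ = 1`.

The homotopy runs in state space. `IsRHInf.exists_realization` gives a realization of `H` with no
eigenvalue in the closed right half plane. Closing the loop with `e = -τ y` gives the state matrix
`A - τ B (I + τ D)⁻¹ C`, where `I + τ D` is invertible by the condition at `ω = ∞`. An eigenvalue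
`s` of it with `Re s ≥ 0` yields `w ≠ 0` with `w + τ H(s) w = 0`
(`StateSpace.exists_of_closedLoop_eigenvalue`), so no eigenvalue is imaginary; negative frequencies
follow by conjugation, since the matrices are real. At `τ = 0` the matrix is stable, hence it is
stable at `τ = 1` (`hurwitz_of_homotopy`).

A stable state matrix gives a finite `L²` gain without Fourier analysis (`energy_le_of_hurwitz`):
the characteristic polynomial is split into linear factors, each a scalar mode with an elementary
energy estimate, and Cayley–Hamilton closes the recursion.

The response relation admits every realization of `H`, including those with hidden unstable modes.
`StateSpace.IsResponse.ae_eq` removes this freedom: the transfer function determines the Markov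
parameters `C Aᵏ B`, and these determine the zero-state response. Every solution of the loop is
therefore described by the one stable realization. -/

/-- Functions that are integrable on every interval `[0, T]`. -/
def LocInt (f : ℝ → E) : Prop := ∀ T : ℝ, 0 ≤ T → IntervalIntegrable f volume 0 T

theorem LocInt.add {f g : ℝ → E} (hf : LocInt f) (hg : LocInt g) :
    LocInt (fun t => f t + g t) :=
  fun T hT => (hf T hT).add (hg T hT)

theorem LocInt.sub {f g : ℝ → E} (hf : LocInt f) (hg : LocInt g) :
    LocInt (fun t => f t - g t) :=
  fun T hT => (hf T hT).sub (hg T hT)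

theorem _root_.ContinuousOn.locInt {x : ℝ → E} (hx : ContinuousOn x (Ici 0)) : LocInt x :=
  fun T hT => (hx.mono (by rw [uIcc_of_le hT]; exact Icc_subset_Ici_self)).intervalIntegrable

variable [NormedSpace ℝ E] [NormedSpace ℝ F]

/-- `x` solves `x' = A x + f`, `x(0) = 0` in integrated form. -/
structure IntegralSolution (A : E →L[ℝ] E) (f x : ℝ → E) : Prop where
  cont : ContinuousOn x (Ici 0)
  eq : ∀ t : ℝ, 0 ≤ t → x t = ∫ s in (0 : ℝ)..t, (A (x s) + f s)

theorem LocInt.map {f : ℝ → E} (hf : LocInt f) (L : E →L[ℝ] F) : LocInt (fun t => L (f t)) :=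
  fun T hT => by
    have := hf T hT
    rw [intervalIntegrable_iff] at this ⊢
    exact L.integrable_comp this

theorem IntegralSolution.locInt {A : E →L[ℝ] E} {f x : ℝ → E} (h : IntegralSolution A f x)
    (hf : LocInt f) : LocInt (fun t => A (x t) + f t) :=
  (h.cont.locInt.map A).add hf

theorem IntegralSolution.apply_eq [CompleteSpace E] [CompleteSpace F] {A : E →L[ℝ] E}
    {f x : ℝ → E} (h : IntegralSolution A f x) (hf : LocInt f) (L : E →L[ℝ] F) {t : ℝ}
    (ht : 0 ≤ t) : L (x t) = ∫ s in (0 : ℝ)..t, (L (A (x s)) + L (f s)) := by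
  rw [h.eq t ht, ← L.intervalIntegral_comp_comm (h.locInt hf t ht)]
  simp

theorem IntegralSolution.map [CompleteSpace E] [CompleteSpace F] {A : E →L[ℝ] E}
    {f x : ℝ → E} (h : IntegralSolution A f x) (hf : LocInt f) {A' : F →L[ℝ] F} (L : E →L[ℝ] F)
    (hL : ∀ v, L (A v) = A' (L v)) :
    IntegralSolution A' (fun t => L (f t)) (fun t => L (x t)) where
  cont := L.continuous.comp_continuousOn h.cont
  eq t ht := by simpa only [hL] using h.apply_eq hf L ht

theorem IntegralSolution.sub [CompleteSpace E] {A : E →L[ℝ] E} {f g x y : ℝ → E}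
    (hx : IntegralSolution A f x) (hy : IntegralSolution A g y) (hf : LocInt f) (hg : LocInt g) :
    IntegralSolution A (fun t => f t - g t) (fun t => x t - y t) where
  cont := hx.cont.sub hy.cont
  eq t ht := by
    rw [hx.eq t ht, hy.eq t ht,
      ← intervalIntegral.integral_sub (hx.locInt hf t ht) (hy.locInt hg t ht)]
    refine intervalIntegral.integral_congr fun s _ => ?_
    simp only [map_sub]
    abel

theorem norm_pow_apply_le (A : E →L[ℝ] E) (j : ℕ) (v : E) : ‖(A ^ j) v‖ ≤ ‖A‖ ^ j * ‖v‖ := by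
  induction j generalizing v with
  | zero => simp
  | succ j ih =>
    rw [pow_succ, pow_succ, mul_assoc]
    exact (ih (A v)).trans (by gcongr; exact A.le_opNorm v)

/-- A component of the solution on which neither the forcing nor its propagation under `A` has
any influence vanishes. -/
theorem IntegralSolution.apply_eq_zero [CompleteSpace E] [CompleteSpace F] {A : E →L[ℝ] E}
    {f x : ℝ → E} (h : IntegralSolution A f x) (hf : LocInt f) (C : E →L[ℝ] F)
    (hC : ∀ (k : ℕ) (s : ℝ), C ((A ^ k) (f s)) = 0) {T : ℝ} (hT : 0 ≤ T) : C (x T) = 0 := by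
  obtain ⟨M, hM⟩ := (isCompact_Icc (a := (0 : ℝ)) (b := T)).exists_bound_of_continuousOn
    (h.cont.mono Icc_subset_Ici_self)
  have hM0 : 0 ≤ M := (norm_nonneg _).trans (hM 0 ⟨le_rfl, hT⟩)
  -- Since the forcing terms vanish, `C Aʲ x` is the primitive of `C Aʲ⁺¹ x`. Iterating `k` times
  -- gives the factor `tᵏ / k!`; each step raises `j`, so `j` stays quantified in the induction.
  have key : ∀ k j : ℕ, ∀ t ∈ Icc 0 T,
      ‖C ((A ^ j) (x t))‖ ≤ ‖C‖ * ‖A‖ ^ (j + k) * M * (t ^ k / k.factorial) := by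
    intro k
    induction k with
    | zero =>
      intro j t ht
      calc ‖C ((A ^ j) (x t))‖ ≤ ‖C‖ * ‖(A ^ j) (x t)‖ := C.le_opNorm _
        _ ≤ ‖C‖ * (‖A‖ ^ j * M) := by
          gcongr
          exact (norm_pow_apply_le A j _).trans (by gcongr; exact hM t ht)
        _ = _ := by simp [mul_assoc]
    | succ k ih =>
      intro j t ht
      have h1 := h.apply_eq hf (C.comp (A ^ j)) ht.1
      simp only [ContinuousLinearMap.comp_apply, hC, add_zero] at h1
      rw [h1]
      have h2 : ∀ s, C ((A ^ j) (A (x s))) = C ((A ^ (j + 1)) (x s)) := fun s => by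
        rw [pow_succ]; rfl
      simp only [h2]
      have h3 : ∫ s in (0 : ℝ)..t, ‖C‖ * ‖A‖ ^ (j + 1 + k) * M * (s ^ k / k.factorial) =
          ‖C‖ * ‖A‖ ^ (j + (k + 1)) * M * (t ^ (k + 1) / (k + 1).factorial) := by
        rw [intervalIntegral.integral_const_mul, intervalIntegral.integral_div, integral_pow,
          Nat.factorial_succ, add_assoc, add_comm 1 k]
        push_cast
        have : (k.factorial : ℝ) ≠ 0 := by positivity
        have : (k + 1 : ℝ) ≠ 0 := by positivity
        field_simp
        simp
      rw [← h3]
      refine intervalIntegral.norm_integral_le_of_norm_le ht.1 ?_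
        (Continuous.intervalIntegrable (by fun_prop) _ _)
      exact Filter.Eventually.of_forall fun s hs =>
        ih (j + 1) s ⟨hs.1.le, hs.2.trans ht.2⟩
  have lim : Filter.Tendsto (fun k : ℕ => ‖C‖ * M * ((‖A‖ * T) ^ k / k.factorial))
      Filter.atTop (nhds (‖C‖ * M * 0)) :=
    (FloorSemiring.tendsto_pow_div_factorial_atTop _).const_mul _
  rw [mul_zero] at lim
  have := ge_of_tendsto' lim (b := ‖C (x T)‖) fun k => by
    have := key k 0 T ⟨hT, le_rfl⟩
    rw [pow_zero, zero_add] at this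
    refine this.trans (le_of_eq ?_)
    rw [mul_pow]; ring
  exact norm_le_zero_iff.1 this

theorem IntegralSolution.unique [CompleteSpace E] {A : E →L[ℝ] E} {f x y : ℝ → E}
    (hx : IntegralSolution A f x) (hy : IntegralSolution A f y) (hf : LocInt f) {t : ℝ}
    (ht : 0 ≤ t) : x t = y t := by
  have h := hx.sub hy hf hf
  have := h.apply_eq_zero (hf.sub hf) (ContinuousLinearMap.id ℝ E) (fun k s => by simp) ht
  simpa [sub_eq_zero] using this

/-- The forcing is merely integrable, so variation of constants is not applied to it directly. With
`F` the primitive of `f`, the ansatz `x = F + v` leaves `v' = A v + A F`, whose forcing is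
continuous and whose solution is differentiable everywhere. -/
theorem exists_integralSolution [CompleteSpace E] (A : E →L[ℝ] E) {f : ℝ → E} (hf : LocInt f) :
    ∃ x, IntegralSolution A f x := by
  -- Nothing is known about `f` at negative times; cutting it off there makes the primitive
  -- continuous on all of `ℝ`.
  set g : ℝ → E := (Ioi 0).indicator f with hg
  have hgi : ∀ a b, IntervalIntegrable g volume a b := by
    have h0 : ∀ b, IntervalIntegrable g volume 0 b := by
      intro b
      rcases le_total 0 b with hb | hb
      · refine (hf b hb).congr ?_
        intro s hs
        rw [uIoc_of_le hb] at hs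
        simp [hg, hs.1]
      · refine (intervalIntegrable_const (c := (0 : E))).congr ?_
        intro s hs
        rw [uIoc_of_ge hb] at hs
        simp [hg, hs.2]
    exact fun a b => (h0 a).symm.trans (h0 b)
  set F : ℝ → E := fun t => ∫ s in (0 : ℝ)..t, g s with hF
  have hFc : Continuous F := intervalIntegral.continuous_primitive hgi 0
  have hexp : ∀ (t : ℝ), HasDerivAt (fun t : ℝ => NormedSpace.exp (t • A))
      (A * NormedSpace.exp (t • A)) t := fun t => hasDerivAt_exp_smul_const' A t
  have hexpc : Continuous fun t : ℝ => NormedSpace.exp (t • A) :=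
    continuous_iff_continuousAt.2 fun t => (hexp t).continuousAt
  set k : ℝ → E := fun s => NormedSpace.exp ((-s) • A) (A (F s)) with hk
  have hkc : Continuous k := by
    have h1 : Continuous fun s : ℝ => NormedSpace.exp ((-s) • A) := hexpc.comp continuous_neg
    exact h1.clm_apply (A.continuous.comp hFc)
  set v : ℝ → E := fun t => NormedSpace.exp (t • A) (∫ s in (0 : ℝ)..t, k s) with hv
  have hvd : ∀ t, HasDerivAt v (A (v t) + A (F t)) t := by
    intro t
    have h1 := (hexp t).clm_apply (hkc.integral_hasStrictDerivAt 0 t).hasDerivAt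
    convert h1 using 1
    let _ : NormedAlgebra ℚ (E →L[ℝ] E) := NormedAlgebra.restrictScalars ℚ ℝ _
    have h2 : NormedSpace.exp (t • A) * NormedSpace.exp ((-t) • A) = 1 := by
      rw [neg_smul, ← NormedSpace.exp_add_of_commute ((Commute.refl (t • A)).neg_right)]
      simp
    have h3 : NormedSpace.exp (t • A) (k t) = A (F t) := by
      change (NormedSpace.exp (t • A) * NormedSpace.exp ((-t) • A)) (A (F t)) = _
      rw [h2]; rfl
    rw [h3]; rfl
  have hvc : Continuous v := continuous_iff_continuousAt.2 fun t => (hvd t).continuousAt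
  refine ⟨fun t => F t + v t, (hFc.add hvc).continuousOn, fun t ht => ?_⟩
  have h1 : ∫ s in (0 : ℝ)..t, (A (v s) + A (F s)) = v t := by
    rw [intervalIntegral.integral_eq_sub_of_hasDerivAt (fun s _ => hvd s)
      (Continuous.intervalIntegrable (by fun_prop) _ _)]
    simp [hv]
  have h2 : F t = ∫ s in (0 : ℝ)..t, f s := by
    refine intervalIntegral.integral_congr_ae (Filter.Eventually.of_forall fun s hs => ?_)
    rw [uIoc_of_le ht] at hs
    simp [hg, hs.1]
  calc F t + v t = (∫ s in (0 : ℝ)..t, f s) + ∫ s in (0 : ℝ)..t, (A (v s) + A (F s)) := by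
        rw [h1, h2]
    _ = _ := by
      rw [← intervalIntegral.integral_add (hf t ht)
        (Continuous.intervalIntegrable (by fun_prop) _ _)]
      refine intervalIntegral.integral_congr fun s _ => ?_
      simp only [map_add]
      abel

end IntegralSolution

end

section

open MeasureTheory Set

/-! ### Energy estimates -/

/-- The product rule for absolutely continuous functions: the primitive of an integrable `h` has
derivative `h` almost everywhere. -/
theorem sq_primitive {h : ℝ → ℝ} {T : ℝ} (hh : IntervalIntegrable h volume 0 T) :
    (∫ s in (0 : ℝ)..T, h s) ^ 2 = 2 * ∫ t in (0 : ℝ)..T, (∫ s in (0 : ℝ)..t, h s) * h t := by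
  have hac := hh.absolutelyContinuousOnInterval_intervalIntegral left_mem_uIcc
  have h1 := hac.integral_deriv_mul_eq_sub hac
  simp only [intervalIntegral.integral_same, mul_zero, sub_zero] at h1
  rw [sq, ← h1, ← intervalIntegral.integral_const_mul]
  refine intervalIntegral.integral_congr_ae ?_
  filter_upwards [hh.ae_hasDerivAt_integral] with t ht htT
  rw [(ht (uIoc_subset_uIcc htT) 0 left_mem_uIcc).deriv]
  ring

theorem norm_sq_primitive {h x : ℝ → ℂ} {T : ℝ} (hT : 0 ≤ T)
    (hh : IntervalIntegrable h volume 0 T)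
    (hx : ∀ t ∈ Icc 0 T, x t = ∫ s in (0 : ℝ)..t, h s) :
    ‖x T‖ ^ 2 = 2 * ∫ t in (0 : ℝ)..T, (star (x t) * h t).re := by
  have hre : IntervalIntegrable (fun s => (h s).re) volume 0 T := by
    rw [intervalIntegrable_iff] at hh ⊢; exact hh.re
  have him : IntervalIntegrable (fun s => (h s).im) volume 0 T := by
    rw [intervalIntegrable_iff] at hh ⊢; exact hh.im
  have hi : ∀ t ∈ Icc 0 T, IntervalIntegrable h volume 0 t := fun t ht =>
    hh.mono_set (by rw [uIcc_of_le ht.1, uIcc_of_le hT]; exact Icc_subset_Icc_right ht.2)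
  have xre : ∀ t ∈ Icc 0 T, (x t).re = ∫ s in (0 : ℝ)..t, (h s).re := fun t ht => by
    rw [hx t ht]; exact (Complex.reCLM.intervalIntegral_comp_comm (hi t ht)).symm
  have xim : ∀ t ∈ Icc 0 T, (x t).im = ∫ s in (0 : ℝ)..t, (h s).im := fun t ht => by
    rw [hx t ht]; exact (Complex.imCLM.intervalIntegral_comp_comm (hi t ht)).symm
  have hTT : T ∈ Icc 0 T := ⟨hT, le_rfl⟩
  have hc := fun {k : ℝ → ℝ} (hk : IntervalIntegrable k volume 0 T) =>
    (intervalIntegral.continuousOn_primitive_interval'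
      hk (a := 0) left_mem_uIcc)
  rw [← Complex.normSq_eq_norm_sq, Complex.normSq_apply, xre T hTT, xim T hTT, ← sq, ← sq,
    sq_primitive hre, sq_primitive him, ← mul_add, ← intervalIntegral.integral_add]
  · congr 1
    refine intervalIntegral.integral_congr fun t ht => ?_
    rw [uIcc_of_le hT] at ht
    simp [xre t ht, xim t ht]
  · exact hre.continuousOn_mul (hc hre)
  · exact him.continuousOn_mul (hc him)

/-- A stable scalar mode `x' = lam x + g` has the `L²` gain `1 / |Re lam|`. -/
theorem scalar_energy_le {x g : ℝ → ℂ} {lam : ℂ} (hlam : lam.re < 0) {T : ℝ} (hT : 0 ≤ T)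
    (hx : ContinuousOn x (Icc 0 T)) (hg : IntervalIntegrable g volume 0 T)
    (hg2 : IntervalIntegrable (fun t => ‖g t‖ ^ 2) volume 0 T)
    (heq : ∀ t ∈ Icc 0 T, x t = ∫ s in (0 : ℝ)..t, (lam * x s + g s)) :
    ∫ t in (0 : ℝ)..T, ‖x t‖ ^ 2 ≤ (lam.re ^ 2)⁻¹ * ∫ t in (0 : ℝ)..T, ‖g t‖ ^ 2 := by
  have hxc : ContinuousOn x (uIcc 0 T) := by rwa [uIcc_of_le hT]
  have hh : IntervalIntegrable (fun s => lam * x s + g s) volume 0 T :=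
    (hxc.intervalIntegrable.const_mul lam).add hg
  have h1 := norm_sq_primitive hT hh heq
  have hx2 : IntervalIntegrable (fun t => ‖x t‖ ^ 2) volume 0 T :=
    (hxc.norm.pow 2).intervalIntegrable
  have hcross : IntervalIntegrable (fun t => (star (x t) * (lam * x t + g t)).re) volume 0 T := by
    have := hh.continuousOn_mul (continuous_star.comp_continuousOn hxc)
    rw [intervalIntegrable_iff] at this ⊢
    exact this.re
  have hpt : ∀ t, 2 * (star (x t) * (lam * x t + g t)).re ≤
      lam.re * ‖x t‖ ^ 2 + (-lam.re)⁻¹ * ‖g t‖ ^ 2 := by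
    intro t
    have e1 : (star (x t) * (lam * x t + g t)).re =
        lam.re * ‖x t‖ ^ 2 + (star (x t) * g t).re := by
      rw [← Complex.normSq_eq_norm_sq, Complex.normSq_apply]
      simp
      ring
    have e2 : (star (x t) * g t).re ≤ ‖x t‖ * ‖g t‖ :=
      (Complex.re_le_norm _).trans (by simp)
    have ha : 0 < -lam.re := by linarith
    -- Young's inequality, weighted so that the cross term consumes exactly half of the dissipation
    -- `2 Re lam ‖x‖²`.
    have e3 : 2 * (‖x t‖ * ‖g t‖) ≤ (-lam.re) * ‖x t‖ ^ 2 + (-lam.re)⁻¹ * ‖g t‖ ^ 2 := by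
      have hne := hlam.ne
      have := mul_nonneg (inv_nonneg.2 ha.le) (sq_nonneg ((-lam.re) * ‖x t‖ - ‖g t‖))
      have e4 : (-lam.re)⁻¹ * ((-lam.re) * ‖x t‖ - ‖g t‖) ^ 2 =
        (-lam.re) * ‖x t‖ ^ 2 + (-lam.re)⁻¹ * ‖g t‖ ^ 2 - 2 * (‖x t‖ * ‖g t‖) := by
        field_simp
        ring
      linarith
    rw [e1]
    linarith
  have h2 : (0 : ℝ) ≤ ∫ t in (0 : ℝ)..T, (lam.re * ‖x t‖ ^ 2 + (-lam.re)⁻¹ * ‖g t‖ ^ 2) := by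
    calc (0 : ℝ) ≤ ‖x T‖ ^ 2 := by positivity
      _ = ∫ t in (0 : ℝ)..T, 2 * (star (x t) * (lam * x t + g t)).re := by
        rw [h1, intervalIntegral.integral_const_mul]
      _ ≤ _ := intervalIntegral.integral_mono_on hT (hcross.const_mul 2)
        ((hx2.const_mul _).add (hg2.const_mul _)) fun t _ => hpt t
  rw [intervalIntegral.integral_add (hx2.const_mul _) (hg2.const_mul _),
    intervalIntegral.integral_const_mul, intervalIntegral.integral_const_mul] at h2
  have ha : 0 < -lam.re := by linarith
  have h3 := mul_nonneg (inv_nonneg.2 ha.le) h2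
  have h4 : (-lam.re)⁻¹ * (-lam.re)⁻¹ = (lam.re ^ 2)⁻¹ := by rw [← mul_inv]; ring
  have h5 : (-lam.re)⁻¹ * lam.re = -1 := by field_simp [hlam.ne]
  rw [mul_add, ← mul_assoc, ← mul_assoc, h4, h5] at h3
  linarith

/-- Functions whose squared norm is integrable on every interval `[0, T]`. -/
def LocSqInt {E : Type*} [NormedAddCommGroup E] (f : ℝ → E) : Prop :=
  ∀ T : ℝ, 0 ≤ T → MemLp f 2 (volume.restrict (Icc 0 T))

section LocSqInt

variable {E F : Type*} [NormedAddCommGroup E] [NormedAddCommGroup F]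

theorem LocSqInt.locInt {f : ℝ → E} (hf : LocSqInt f) : LocInt f := fun T hT => by
  rw [intervalIntegrable_iff_integrableOn_Icc_of_le hT]
  exact (hf T hT).integrable (by norm_num)

theorem LocSqInt.sq {f : ℝ → E} (hf : LocSqInt f) {T : ℝ} (hT : 0 ≤ T) :
    IntervalIntegrable (fun t => ‖f t‖ ^ 2) volume 0 T := by
  rw [intervalIntegrable_iff_integrableOn_Icc_of_le hT]
  exact (hf T hT).integrable_norm_pow (by norm_num)

theorem LocSqInt.add {f g : ℝ → E} (hf : LocSqInt f) (hg : LocSqInt g) :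
    LocSqInt (fun t => f t + g t) := fun T hT => (hf T hT).add (hg T hT)

theorem LocSqInt.sub {f g : ℝ → E} (hf : LocSqInt f) (hg : LocSqInt g) :
    LocSqInt (fun t => f t - g t) := fun T hT => (hf T hT).sub (hg T hT)

theorem LocSqInt.map [NormedSpace ℝ E] [NormedSpace ℝ F] {f : ℝ → E} (hf : LocSqInt f)
    (L : E →L[ℝ] F) : LocSqInt (fun t => L (f t)) := fun T hT => L.comp_memLp' (hf T hT)

theorem _root_.ContinuousOn.locSqInt {x : ℝ → E} (hx : ContinuousOn x (Ici 0)) :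
    LocSqInt x := fun T hT => by
  have hc : ContinuousOn x (Icc 0 T) := hx.mono Icc_subset_Ici_self
  have hm := hc.aestronglyMeasurable_of_isCompact isCompact_Icc measurableSet_Icc (μ := volume)
  obtain ⟨M, hM⟩ := isCompact_Icc.exists_bound_of_continuousOn hc
  refine MemLp.of_bound hm M ?_
  filter_upwards [ae_restrict_mem measurableSet_Icc] with t ht using hM t ht

theorem sum_sq_integral {N : ℕ} {f : ℝ → EuclideanSpace ℂ (Fin N)} (hf : LocSqInt f) {T : ℝ}
    (hT : 0 ≤ T) :
    ∫ t in (0 : ℝ)..T, ‖f t‖ ^ 2 = ∑ i, ∫ t in (0 : ℝ)..T, ‖f t i‖ ^ 2 := by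
  rw [← intervalIntegral.integral_finsetSum]
  · exact intervalIntegral.integral_congr fun t _ => EuclideanSpace.norm_sq_eq _
  · intro i _
    exact (hf.map ((EuclideanSpace.proj i : EuclideanSpace ℂ (Fin N) →L[ℂ] ℂ).restrictScalars ℝ)).sq hT

end LocSqInt

/-- The system matrix is a multiple of the identity, so the coordinates decouple into scalar modes
with the same gain. -/
theorem vector_energy_le {N : ℕ} {x g : ℝ → EuclideanSpace ℂ (Fin N)} {lam : ℂ}
    (hlam : lam.re < 0) (hg : LocSqInt g)
    (hx : IntegralSolution ((lam • ContinuousLinearMap.id ℂ _).restrictScalars ℝ) g x) {T : ℝ}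
    (hT : 0 ≤ T) :
    ∫ t in (0 : ℝ)..T, ‖x t‖ ^ 2 ≤ (lam.re ^ 2)⁻¹ * ∫ t in (0 : ℝ)..T, ‖g t‖ ^ 2 := by
  rw [sum_sq_integral hx.cont.locSqInt hT, sum_sq_integral hg hT, Finset.mul_sum]
  refine Finset.sum_le_sum fun i _ => ?_
  set L := (EuclideanSpace.proj i : EuclideanSpace ℂ (Fin N) →L[ℂ] ℂ).restrictScalars ℝ with hL
  refine scalar_energy_le hlam hT
    ((L.continuous.comp_continuousOn hx.cont).mono Icc_subset_Ici_self)
    ((hg.map L).locInt T hT) ((hg.map L).sq hT) fun t ht => ?_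
  have := hx.apply_eq hg.locInt L ht.1
  simpa [hL] using this

theorem integral_sq_map_le {E F : Type*} [NormedAddCommGroup E] [NormedAddCommGroup F]
    [NormedSpace ℝ E] [NormedSpace ℝ F] {f : ℝ → E} (hf : LocSqInt f) (L : E →L[ℝ] F) {T : ℝ}
    (hT : 0 ≤ T) :
    ∫ t in (0 : ℝ)..T, ‖L (f t)‖ ^ 2 ≤ ‖L‖ ^ 2 * ∫ t in (0 : ℝ)..T, ‖f t‖ ^ 2 := by
  rw [← intervalIntegral.integral_const_mul]
  refine intervalIntegral.integral_mono_on hT ((hf.map L).sq hT) ((hf.sq hT).const_mul _)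
    fun t _ => ?_
  rw [← mul_pow]
  gcongr
  exact L.le_opNorm _

theorem integral_sq_add_le {E : Type*} [NormedAddCommGroup E] {f g : ℝ → E} (hf : LocSqInt f)
    (hg : LocSqInt g) {T : ℝ} (hT : 0 ≤ T) :
    ∫ t in (0 : ℝ)..T, ‖f t + g t‖ ^ 2 ≤
      2 * (∫ t in (0 : ℝ)..T, ‖f t‖ ^ 2) + 2 * ∫ t in (0 : ℝ)..T, ‖g t‖ ^ 2 := by
  rw [← intervalIntegral.integral_const_mul, ← intervalIntegral.integral_const_mul,
    ← intervalIntegral.integral_add ((hf.sq hT).const_mul _) ((hg.sq hT).const_mul _)]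
  refine intervalIntegral.integral_mono_on hT ((hf.add hg).sq hT)
    (((hf.sq hT).const_mul _).add ((hg.sq hT).const_mul _)) fun t _ => ?_
  have := norm_add_le (f t) (g t)
  have h2 : ‖f t + g t‖ ^ 2 ≤ (‖f t‖ + ‖g t‖) ^ 2 := by gcongr
  nlinarith [sq_nonneg (‖f t‖ - ‖g t‖)]

open Polynomial in
/-- The energy of a state is bounded by the energy of the forcing as soon as that holds for its
image under a polynomial in the system matrix all of whose roots are stable. -/
theorem energy_le_of_prod {N : ℕ}
    (M : EuclideanSpace ℂ (Fin N) →L[ℂ] EuclideanSpace ℂ (Fin N)) (l : List ℂ)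
    (hl : ∀ lam ∈ l, lam.re < 0) : ∀ c : ℝ, 0 ≤ c → ∃ γ : ℝ, 0 ≤ γ ∧
      ∀ f x : ℝ → EuclideanSpace ℂ (Fin N), LocSqInt f →
        IntegralSolution (M.restrictScalars ℝ) f x → ∀ T : ℝ, 0 ≤ T →
        ∫ t in (0 : ℝ)..T, ‖aeval M (l.map fun lam => X - C lam).prod (x t)‖ ^ 2 ≤
          c * ∫ t in (0 : ℝ)..T, ‖f t‖ ^ 2 →
        ∫ t in (0 : ℝ)..T, ‖x t‖ ^ 2 ≤ γ * ∫ t in (0 : ℝ)..T, ‖f t‖ ^ 2 := by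
  -- The constant `c` stays quantified because each removed factor replaces it by a larger
  -- expression.
  induction l with
  | nil => exact fun c hc => ⟨c, hc, fun f x _ _ T _ h => by simpa using h⟩
  | cons lam l ih =>
    intro c hc
    have hlam := hl lam List.mem_cons_self
    set P := aeval M (l.map fun lam => X - C lam).prod with hP
    -- The factor `(Re lam)⁻²` is the gain of the scalar mode satisfied by `P x`; the bracket bounds
    -- its forcing `Q x + P f`, with `2 c` for `Q x` and `2 ‖P‖²` for `P f`.
    obtain ⟨γ, hγ, h⟩ := ih (fun a ha => hl a (List.mem_cons_of_mem _ ha))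
      ((lam.re ^ 2)⁻¹ * (2 * c + 2 * ‖P.restrictScalars ℝ‖ ^ 2)) (by positivity)
    refine ⟨γ, hγ, fun f x hf hx T hT hc' => h f x hf hx T hT ?_⟩
    have hcomm : ∀ v, P (M v) = M (P v) := fun v => by
      have : Commute P M := by
        simpa only [aeval_X] using
          (Commute.all (l.map fun lam => (X - C lam : ℂ[X])).prod X).map (aeval M)
      exact congrArg (fun L : EuclideanSpace ℂ (Fin N) →L[ℂ] EuclideanSpace ℂ (Fin N) => L v)
        this.eq
    set Q := aeval M ((lam :: l).map fun lam => X - C lam).prod with hQ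
    have hQP : ∀ v, Q v = M (P v) - lam • P v := fun v => by
      rw [hQ, List.map_cons, List.prod_cons, map_mul, ← hP]
      simp [Algebra.algebraMap_eq_smul_one]
    have hz : IntegralSolution ((lam • ContinuousLinearMap.id ℂ _).restrictScalars ℝ)
        (fun t => Q (x t) + P (f t)) (fun t => P (x t)) := by
      refine ⟨P.continuous.comp_continuousOn hx.cont, fun t ht => ?_⟩
      have := hx.apply_eq hf.locInt (P.restrictScalars ℝ) ht
      simp only [ContinuousLinearMap.coe_restrictScalars'] at this
      rw [this]
      refine intervalIntegral.integral_congr fun s _ => ?_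
      simp only [hQP, hcomm, ContinuousLinearMap.coe_restrictScalars',
        _root_.smul_apply, ContinuousLinearMap.id_apply]
      abel
    have hPf : LocSqInt fun t => P (f t) := hf.map (P.restrictScalars ℝ)
    have hQx : LocSqInt fun t => Q (x t) := hx.cont.locSqInt.map (Q.restrictScalars ℝ)
    refine (vector_energy_le hlam (hQx.add hPf) hz hT).trans ?_
    rw [mul_assoc]
    gcongr
    refine (integral_sq_add_le hQx hPf hT).trans ?_
    have := integral_sq_map_le hf (P.restrictScalars ℝ) hT
    simp only [ContinuousLinearMap.coe_restrictScalars'] at this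
    linarith

open Polynomial in
/-- A linear differential equation whose matrix has all its eigenvalues in the open left half
plane has finite `L²` gain from the forcing to the state. -/
theorem energy_le_of_hurwitz {N : ℕ} (A : Matrix (Fin N) (Fin N) ℂ)
    (hA : ∀ s : ℂ, A.charpoly.IsRoot s → s.re < 0) : ∃ γ : ℝ, 0 ≤ γ ∧
      ∀ f x : ℝ → EuclideanSpace ℂ (Fin N), LocSqInt f →
        IntegralSolution ((Matrix.toEuclideanCLM (𝕜 := ℂ) A).restrictScalars ℝ) f x →
        ∀ T : ℝ, 0 ≤ T →
        ∫ t in (0 : ℝ)..T, ‖x t‖ ^ 2 ≤ γ * ∫ t in (0 : ℝ)..T, ‖f t‖ ^ 2 := by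
  have hprod : (A.charpoly.roots.toList.map fun lam => X - C lam).prod = A.charpoly := by
    have h1 := (IsAlgClosed.splits A.charpoly).eq_prod_roots_of_monic A.charpoly_monic
    conv_rhs => rw [h1, ← Multiset.coe_toList A.charpoly.roots]
    rw [Multiset.map_coe, Multiset.prod_coe]
  -- The recursion starts at `c = 0`: by Cayley–Hamilton the full product annihilates the state.
  obtain ⟨γ, hγ, h⟩ := energy_le_of_prod (Matrix.toEuclideanCLM (𝕜 := ℂ) A)
    A.charpoly.roots.toList (fun s hs => hA s (by
      rw [Multiset.mem_toList] at hs; exact Polynomial.isRoot_of_mem_roots hs)) 0 le_rfl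
  refine ⟨γ, hγ, fun f x hf hx T hT => h f x hf hx T hT ?_⟩
  rw [hprod]
  have h0 : aeval (Matrix.toEuclideanCLM (𝕜 := ℂ) A) A.charpoly = 0 := by
    have := Polynomial.aeval_algHom_apply
      ((Matrix.toEuclideanCLM (𝕜 := ℂ) (n := Fin N)).toAlgEquiv.toAlgHom) A A.charpoly
    rw [Matrix.aeval_self_charpoly, map_zero] at this
    exact this
  simp [h0]

end

section

open MeasureTheory Set

/-! ### Realizations of the same transfer function have the same responses -/

section Act

variable {𝕜 : Type*} [RCLike 𝕜]

/-- `act` as a continuous linear map. -/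
def actL {p m : ℕ} (M : Matrix (Fin p) (Fin m) ℝ) :
    EuclideanSpace 𝕜 (Fin m) →L[ℝ] EuclideanSpace 𝕜 (Fin p) :=
  (LinearMap.toContinuousLinearMap (𝕜 := 𝕜)
    { toFun := act M
      map_add' := fun v w => by simp [act, Matrix.mulVec_add]
      map_smul' := fun c v => by simp [act, Matrix.mulVec_smul] }).restrictScalars ℝ

theorem actL_apply {p m : ℕ} (M : Matrix (Fin p) (Fin m) ℝ) (v : EuclideanSpace 𝕜 (Fin m)) :
    actL M v = act M v := rfl

theorem act_mul {p m k : ℕ} (M : Matrix (Fin p) (Fin m) ℝ) (L : Matrix (Fin m) (Fin k) ℝ)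
    (v : EuclideanSpace 𝕜 (Fin k)) : act (M * L) v = act M (act L v) := by
  simp [act, Matrix.map_mul]

theorem act_one {m : ℕ} (v : EuclideanSpace 𝕜 (Fin m)) : act 1 v = v := by
  simp [act]

theorem act_add_left {p m : ℕ} (M L : Matrix (Fin p) (Fin m) ℝ)
    (v : EuclideanSpace 𝕜 (Fin m)) : act (M + L) v = act M v + act L v := by
  simp [act, Matrix.map_add, Matrix.add_mulVec]

theorem act_sub_left {p m : ℕ} (M L : Matrix (Fin p) (Fin m) ℝ)
    (v : EuclideanSpace 𝕜 (Fin m)) : act (M - L) v = act M v - act L v := by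
  simp [act, Matrix.map_sub, Matrix.sub_mulVec]

theorem act_add {p m : ℕ} (M : Matrix (Fin p) (Fin m) ℝ)
    (v w : EuclideanSpace 𝕜 (Fin m)) : act M (v + w) = act M v + act M w :=
  map_add (actL M) v w

theorem act_sub {p m : ℕ} (M : Matrix (Fin p) (Fin m) ℝ)
    (v w : EuclideanSpace 𝕜 (Fin m)) : act M (v - w) = act M v - act M w :=
  map_sub (actL M) v w

theorem actL_pow {m : ℕ} (M : Matrix (Fin m) (Fin m) ℝ) (k : ℕ)
    (v : EuclideanSpace 𝕜 (Fin m)) : (actL M ^ k) v = act (M ^ k) v := by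
  induction k generalizing v with
  | zero => simp [act_one]
  | succ k ih =>
    rw [pow_succ, pow_succ, act_mul]
    exact ih _

theorem MemL2e.locSqInt {n : ℕ} {u : Signal 𝕜 n} (hu : MemL2e u) : LocSqInt u :=
  fun T _ => hu T

theorem LocSqInt.memL2e {n : ℕ} {u : Signal 𝕜 n} (hu : LocSqInt u) : MemL2e u := fun T => by
  rcases le_or_gt 0 T with hT | hT
  · exact hu T hT
  · rw [Icc_eq_empty (not_le.2 hT), Measure.restrict_empty]
    simp

end Act

/-! ### Strict properness at infinity and Markov parameters -/

section StrictlyProper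

open RatFunc
open scoped Classical

theorem inftyValuation_C_le (a : ℝ) : inftyValuation ℝ (RatFunc.C a) ≤ 1 := by
  by_cases ha : a = 0
  · simp [ha]
  · rw [inftyValuation.C ℝ ha]

theorem eq_zero_of_inftyValuation_C_lt {a : ℝ} (h : inftyValuation ℝ (RatFunc.C a) < 1) :
    a = 0 := by
  by_contra ha
  rw [inftyValuation.C ℝ ha] at h
  exact lt_irrefl _ h

/-- The matrix `(s I - A)⁻¹`. -/
def resolventMatrix {N : ℕ} (A : Matrix (Fin N) (Fin N) ℝ) : Matrix (Fin N) (Fin N) (RatFunc ℝ) :=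
  (Matrix.scalar (Fin N) RatFunc.X - A.map RatFunc.C)⁻¹

theorem isUnit_scalar_sub {N : ℕ} (A : Matrix (Fin N) (Fin N) ℝ) :
    IsUnit (Matrix.scalar (Fin N) RatFunc.X - A.map RatFunc.C).det := by
  have h : Matrix.scalar (Fin N) RatFunc.X - A.map RatFunc.C =
      (algebraMap (Polynomial ℝ) (RatFunc ℝ)).mapMatrix A.charmatrix := by
    ext i j
    by_cases hij : i = j <;> simp [hij]
  rw [h, ← RingHom.map_det]
  exact (((map_ne_zero_iff _ (RatFunc.algebraMap_injective ℝ)).2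
    A.charpoly_monic.ne_zero)).isUnit

theorem X_smul_resolventMatrix {N : ℕ} (A : Matrix (Fin N) (Fin N) ℝ) :
    (RatFunc.X : RatFunc ℝ) • resolventMatrix A = 1 + A.map RatFunc.C * resolventMatrix A := by
  have h := Matrix.mul_nonsing_inv _ (isUnit_scalar_sub A)
  rw [sub_mul, Matrix.scalar_apply, ← Matrix.smul_eq_diagonal_mul] at h
  rw [← h]
  simp [resolventMatrix, Matrix.scalar_apply]

/-- Compare valuations in `X R = 1 + A R` at an entry of maximal valuation in a column. If that
maximum were at least `1`, the right side would not exceed it, while multiplication by `X` strictly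
raises it. -/
theorem inftyValuation_resolventMatrix_lt {N : ℕ} (A : Matrix (Fin N) (Fin N) ℝ) (i j : Fin N) :
    inftyValuation ℝ (resolventMatrix A i j) < 1 := by
  set v := inftyValuation ℝ with hv
  obtain ⟨i₀, -, hi₀⟩ := Finset.exists_max_image Finset.univ
    (fun i => v (resolventMatrix A i j)) ⟨i, Finset.mem_univ i⟩
  refine (hi₀ i (Finset.mem_univ i)).trans_lt ?_
  by_contra! hge
  have h := congrFun (congrFun (X_smul_resolventMatrix A) i₀) j
  rw [Matrix.smul_apply, Matrix.add_apply, Matrix.mul_apply, smul_eq_mul] at h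
  have h1 : v (RatFunc.X * resolventMatrix A i₀ j) ≤ v (resolventMatrix A i₀ j) := by
    rw [h]
    refine (v.map_add _ _).trans (max_le ?_ (v.map_sum_le fun k _ => ?_))
    · refine le_trans ?_ hge
      rw [Matrix.one_apply]
      split_ifs <;> simp
    · rw [map_mul, Matrix.map_apply]
      exact (mul_le_of_le_one_left' (inftyValuation_C_le _)).trans (hi₀ k (Finset.mem_univ k))
  rw [map_mul, hv, inftyValuation.X] at h1
  have h2 : (0 : WithZero (Multiplicative ℤ)) < v (resolventMatrix A i₀ j) :=
    zero_lt_one.trans_le hge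
  have h3 := (mul_le_iff_le_one_left h2).1 h1
  rw [← WithZero.exp_zero, WithZero.exp_le_exp] at h3
  norm_num at h3

theorem inftyValuation_strictlyProper {N m p : ℕ} (A : Matrix (Fin N) (Fin N) ℝ)
    (B : Matrix (Fin N) (Fin m) ℝ) (C : Matrix (Fin p) (Fin N) ℝ) (i : Fin p) (j : Fin m) :
    inftyValuation ℝ ((C.map RatFunc.C * resolventMatrix A * B.map RatFunc.C) i j) < 1 := by
  simp only [Matrix.mul_apply, Finset.sum_mul]
  refine Valuation.map_sum_lt _ one_ne_zero fun k _ =>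
    Valuation.map_sum_lt _ one_ne_zero fun l _ => ?_
  rw [map_mul, map_mul]
  calc _ ≤ 1 * inftyValuation ℝ (resolventMatrix A l k) * 1 := by
        gcongr <;> exact inftyValuation_C_le _
    _ < 1 := by simpa using inftyValuation_resolventMatrix_lt A l k

/-- The difference `D - D'` is constant and also strictly proper, hence zero. -/
theorem eq_of_strictlyProper_add {N N' m p : ℕ} {A : Matrix (Fin N) (Fin N) ℝ}
    {B : Matrix (Fin N) (Fin m) ℝ} {C : Matrix (Fin p) (Fin N) ℝ} {D D' : Matrix (Fin p) (Fin m) ℝ}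
    {A' : Matrix (Fin N') (Fin N') ℝ} {B' : Matrix (Fin N') (Fin m) ℝ}
    {C' : Matrix (Fin p) (Fin N') ℝ}
    (h : C.map RatFunc.C * resolventMatrix A * B.map RatFunc.C + D.map RatFunc.C =
      C'.map RatFunc.C * resolventMatrix A' * B'.map RatFunc.C + D'.map RatFunc.C) :
    D = D' ∧ C.map RatFunc.C * resolventMatrix A * B.map RatFunc.C =
      C'.map RatFunc.C * resolventMatrix A' * B'.map RatFunc.C := by
  have hD : D = D' := by
    ext i j
    have hij := congrFun (congrFun h i) j
    rw [Matrix.add_apply, Matrix.add_apply, Matrix.map_apply, Matrix.map_apply] at hij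
    refine sub_eq_zero.1 (eq_zero_of_inftyValuation_C_lt ?_)
    have e : RatFunc.C (D i j) - RatFunc.C (D' i j) =
        (C'.map RatFunc.C * resolventMatrix A' * B'.map RatFunc.C) i j -
          (C.map RatFunc.C * resolventMatrix A * B.map RatFunc.C) i j := by
      linear_combination hij
    rw [map_sub, e]
    exact Valuation.map_sub_lt _ (inftyValuation_strictlyProper A' B' C' i j)
      (inftyValuation_strictlyProper A B C i j)
  subst hD
  exact ⟨rfl, add_right_cancel h⟩

/-- Multiplication by `s` exposes the Markov parameter `C B` as the value at infinity and replaces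
`C` by `C A`, which is the induction step for reading off all of them. -/
theorem X_smul_mul_resolventMatrix {N m p : ℕ} (A : Matrix (Fin N) (Fin N) ℝ)
    (B : Matrix (Fin N) (Fin m) ℝ) (C : Matrix (Fin p) (Fin N) ℝ) :
    (RatFunc.X : RatFunc ℝ) • (C.map RatFunc.C * resolventMatrix A * B.map RatFunc.C) =
      (C * A).map RatFunc.C * resolventMatrix A * B.map RatFunc.C + (C * B).map RatFunc.C := by
  rw [← Matrix.smul_mul, ← Matrix.mul_smul, X_smul_resolventMatrix, Matrix.mul_add, Matrix.add_mul,
    Matrix.mul_one, Matrix.map_mul, Matrix.map_mul, add_comm]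
  simp only [Matrix.mul_assoc]

/-- The transfer function determines the Markov parameters `C Aᵏ B`. -/
theorem markov_eq {N N' m p : ℕ} {A : Matrix (Fin N) (Fin N) ℝ}
    {B : Matrix (Fin N) (Fin m) ℝ} {A' : Matrix (Fin N') (Fin N') ℝ}
    {B' : Matrix (Fin N') (Fin m) ℝ} (k : ℕ) :
    ∀ {C : Matrix (Fin p) (Fin N) ℝ} {C' : Matrix (Fin p) (Fin N') ℝ},
      C.map RatFunc.C * resolventMatrix A * B.map RatFunc.C =
        C'.map RatFunc.C * resolventMatrix A' * B'.map RatFunc.C →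
      C * A ^ k * B = C' * A' ^ k * B' := by
  induction k with
  | zero =>
    intro C C' h
    have := congrArg (fun M => (RatFunc.X : RatFunc ℝ) • M) h
    simp only [X_smul_mul_resolventMatrix] at this
    simpa using (eq_of_strictlyProper_add this).1
  | succ k ih =>
    intro C C' h
    have := congrArg (fun M => (RatFunc.X : RatFunc ℝ) • M) h
    simp only [X_smul_mul_resolventMatrix] at this
    have := ih (eq_of_strictlyProper_add this).2
    simpa only [pow_succ', Matrix.mul_assoc] using this

end StrictlyProper

/-! ### Independence of the response from the realization -/

section Response

variable {𝕜 : Type*} [RCLike 𝕜]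

/-- Run both systems side by side under the same input. The functional `C x - C' x'` of the joint
state kills every propagated forcing, because the Markov parameters agree, so
`IntegralSolution.apply_eq_zero` applies. -/
theorem StateSpace.IsResponse.ae_eq {N N' m p : ℕ} {S : StateSpace N m p}
    {S' : StateSpace N' m p} (h : S.transferFunction = S'.transferFunction) {u : Signal 𝕜 m}
    {y y' : Signal 𝕜 p} (hy : S.IsResponse u y) (hy' : S'.IsResponse u y') :
    y =ᵐ[timeMeasure] y' := by
  obtain ⟨hu, x, hxc, hx, hxy⟩ := hy
  obtain ⟨-, x', hxc', hx', hxy'⟩ := hy'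
  obtain ⟨hD, hC⟩ := eq_of_strictlyProper_add (D := S.D) (D' := S'.D) h
  have hBu := hu.locSqInt.locInt.map (actL (𝕜 := 𝕜) S.B)
  have hBu' := hu.locSqInt.locInt.map (actL (𝕜 := 𝕜) S'.B)
  have s1 : IntegralSolution (actL S.A) (fun t => actL S.B (u t)) x := ⟨hxc, hx⟩
  have s2 : IntegralSolution (actL S'.A) (fun t => actL S'.B (u t)) x' := ⟨hxc', hx'⟩
  have i1 := s1.locInt hBu
  have i2 := s2.locInt hBu'
  have hpair : LocInt fun t => (actL (𝕜 := 𝕜) S.B (u t), actL (𝕜 := 𝕜) S'.B (u t)) :=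
    hu.locSqInt.locInt.map ((actL (𝕜 := 𝕜) S.B).prod (actL S'.B))
  have s : IntegralSolution ((actL (𝕜 := 𝕜) S.A).prodMap (actL (𝕜 := 𝕜) S'.A))
      (fun t => (actL S.B (u t), actL S'.B (u t))) (fun t => (x t, x' t)) := by
    refine ⟨hxc.prodMk hxc', fun t ht => ?_⟩
    have hi : IntervalIntegrable (fun s => ((actL (𝕜 := 𝕜) S.A).prodMap (actL (𝕜 := 𝕜) S'.A))
        (x s, x' s) + (actL S.B (u s), actL S'.B (u s))) volume 0 t :=
      ((hxc.prodMk hxc').locInt.map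
        ((actL (𝕜 := 𝕜) S.A).prodMap (actL (𝕜 := 𝕜) S'.A))).add hpair t ht
    have f1 := (ContinuousLinearMap.fst ℝ (EuclideanSpace 𝕜 (Fin N))
      (EuclideanSpace 𝕜 (Fin N'))).intervalIntegral_comp_comm hi
    have f2 := (ContinuousLinearMap.snd ℝ (EuclideanSpace 𝕜 (Fin N))
      (EuclideanSpace 𝕜 (Fin N'))).intervalIntegral_comp_comm hi
    refine Prod.ext ?_ ?_
    · exact (s1.eq t ht).trans f1
    · exact (s2.eq t ht).trans f2
  have hpow : ∀ (k : ℕ) (v : EuclideanSpace 𝕜 (Fin N)) (w : EuclideanSpace 𝕜 (Fin N')),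
      (((actL (𝕜 := 𝕜) S.A).prodMap (actL (𝕜 := 𝕜) S'.A)) ^ k) (v, w) =
        ((actL S.A ^ k) v, (actL S'.A ^ k) w) := by
    intro k
    induction k with
    | zero => simp
    | succ k ih =>
      intro v w
      simp only [pow_succ]
      exact ih _ _
  have key := fun T hT => s.apply_eq_zero hpair ((actL (𝕜 := 𝕜) S.C).comp (.fst ℝ _ _) -
    (actL (𝕜 := 𝕜) S'.C).comp (.snd ℝ _ _)) (fun k t => by
      rw [hpow]
      simp only [actL_pow, actL_apply, _root_.sub_apply,
        ContinuousLinearMap.comp_apply, ContinuousLinearMap.coe_fst', ContinuousLinearMap.coe_snd',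
        ← act_mul, ← Matrix.mul_assoc]
      rw [markov_eq k hC, sub_self]) (T := T) hT
  have hae : ∀ᵐ t ∂timeMeasure, (0 : ℝ) ≤ t := ae_restrict_mem measurableSet_Ici
  filter_upwards [hxy, hxy', hae] with t h1 h2 ht
  rw [h1, h2, hD]
  congr 1
  exact sub_eq_zero.1 (key t ht)

end Response

end

section

/-! ### A stable realization -/

section Controllable

open Polynomial

variable {n p : ℕ}

/-- The realization in controllable canonical form of `s ↦ Q(s) / d(s) + D` for a monic
polynomial `d` and a matrix `Q` of polynomials of smaller degree. -/
def controllableForm (d : ℝ[X]) (Q : Matrix (Fin p) (Fin n) ℝ[X])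
    (D : Matrix (Fin p) (Fin n) ℝ) : StateSpace (n * d.natDegree) n p where
  A := Matrix.of fun a b =>
    if (finProdFinEquiv.symm a).1 = (finProdFinEquiv.symm b).1 then
      (if ((finProdFinEquiv.symm b).2 : ℕ) = (finProdFinEquiv.symm a).2 + 1 then 1 else 0) -
        (if ((finProdFinEquiv.symm a).2 : ℕ) + 1 = d.natDegree
          then d.coeff (finProdFinEquiv.symm b).2 else 0)
    else 0
  B := Matrix.of fun a j =>
    if (finProdFinEquiv.symm a).1 = j then
      (if ((finProdFinEquiv.symm a).2 : ℕ) + 1 = d.natDegree then 1 else 0) else 0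
  C := Matrix.of fun k b => (Q k (finProdFinEquiv.symm b).1).coeff (finProdFinEquiv.symm b).2
  D := D

variable {K : Type*} [Field K] (φ : ℝ →+* K) {d : ℝ[X]} {Q : Matrix (Fin p) (Fin n) ℝ[X]}
  {D : Matrix (Fin p) (Fin n) ℝ}

theorem controllableForm_A_mulVec (v : Fin (n * d.natDegree) → K) (j : Fin n)
    (i : Fin d.natDegree) :
    ((controllableForm d Q D).A.map φ).mulVec v (finProdFinEquiv (j, i)) =
      (∑ l : Fin d.natDegree, if (l : ℕ) = i + 1 then v (finProdFinEquiv (j, l)) else 0) -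
        if (i : ℕ) + 1 = d.natDegree then
          ∑ l : Fin d.natDegree, φ (d.coeff l) * v (finProdFinEquiv (j, l)) else 0 := by
  rw [Matrix.mulVec, dotProduct, ← finProdFinEquiv.sum_comp, Fintype.sum_prod_type,
    Finset.sum_eq_single j]
  · simp only [controllableForm, Matrix.map_apply, Matrix.of_apply, Equiv.symm_apply_apply,
      if_true, map_sub, sub_mul, Finset.sum_sub_distrib]
    congr 1
    · refine Finset.sum_congr rfl fun l _ => ?_
      split_ifs <;> simp
    · split_ifs <;> simp
  · intro k _ hk
    refine Finset.sum_eq_zero fun l _ => ?_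
    simp [controllableForm, hk.symm, -finProdFinEquiv_symm_apply]
  · simp

theorem controllableForm_B_mulVec (w : Fin n → K) (j : Fin n) (i : Fin d.natDegree) :
    ((controllableForm d Q D).B.map φ).mulVec w (finProdFinEquiv (j, i)) =
      if (i : ℕ) + 1 = d.natDegree then w j else 0 := by
  rw [Matrix.mulVec, dotProduct, Finset.sum_eq_single j]
  · simp only [controllableForm, Matrix.map_apply, Matrix.of_apply, Equiv.symm_apply_apply,
      if_true]
    split_ifs <;> simp
  · intro k _ hk
    simp [controllableForm, hk.symm, -finProdFinEquiv_symm_apply]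
  · simp

theorem controllableForm_C_mulVec (v : Fin (n * d.natDegree) → K) (k : Fin p) :
    ((controllableForm d Q D).C.map φ).mulVec v k =
      ∑ j : Fin n, ∑ i : Fin d.natDegree, φ ((Q k j).coeff i) * v (finProdFinEquiv (j, i)) := by
  rw [Matrix.mulVec, dotProduct, ← finProdFinEquiv.sum_comp, Fintype.sum_prod_type]
  simp [controllableForm, -finProdFinEquiv_symm_apply]

/-- Each block is a chain of integrators, so its states are successive powers of `s` times the
first, and the last row reads `d(s) v₀ = w`. The field is kept general because the computation is
used twice: at `s = X` in the rational functions for the transfer function, and at complex `s` for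
frequency responses and for the absence of unstable modes (`w = 0`). -/
theorem controllableForm_state (hd : d.Monic) {s : K} (hs : d.eval₂ φ s ≠ 0)
    {v : Fin (n * d.natDegree) → K} {w : Fin n → K}
    (h : s • v = ((controllableForm d Q D).A.map φ).mulVec v +
      ((controllableForm d Q D).B.map φ).mulVec w) (j : Fin n) (i : Fin d.natDegree) :
    v (finProdFinEquiv (j, i)) = s ^ (i : ℕ) * (w j / d.eval₂ φ s) := by
  have heq : ∀ i : Fin d.natDegree, s * v (finProdFinEquiv (j, i)) =
      (∑ l : Fin d.natDegree, if (l : ℕ) = i + 1 then v (finProdFinEquiv (j, l)) else 0) -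
        (if (i : ℕ) + 1 = d.natDegree then
          ∑ l : Fin d.natDegree, φ (d.coeff l) * v (finProdFinEquiv (j, l)) else 0) +
        if (i : ℕ) + 1 = d.natDegree then w j else 0 := by
    intro i
    have := congrFun h (finProdFinEquiv (j, i))
    rwa [Pi.add_apply, controllableForm_A_mulVec, controllableForm_B_mulVec] at this
  have hm : 0 < d.natDegree := i.pos
  have hpow : ∀ (k : ℕ) (hk : k < d.natDegree), v (finProdFinEquiv (j, ⟨k, hk⟩)) =
      s ^ k * v (finProdFinEquiv (j, ⟨0, hm⟩)) := by
    intro k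
    induction k with
    | zero => simp
    | succ k ih =>
      intro hk
      have h1 := heq ⟨k, by omega⟩
      rw [if_neg (by simp; omega), if_neg (by simp; omega),
        Finset.sum_eq_single ⟨k + 1, hk⟩ (fun l _ hl => if_neg fun hl' => hl (Fin.ext hl'))
          (by simp), ih, if_pos rfl] at h1
      rw [pow_succ']
      linear_combination -h1
  -- The last row carries the coefficients of `d` and the input. Together with the powers found
  -- above, it assembles `d(s)`.
  have hlast := heq ⟨d.natDegree - 1, by omega⟩
  have hl : (d.natDegree - 1) + 1 = d.natDegree := by omega
  simp only [hl, if_true] at hlast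
  rw [Finset.sum_eq_zero (fun l _ => if_neg l.isLt.ne), hpow] at hlast
  have hev : d.eval₂ φ s = (∑ l : Fin d.natDegree, φ (d.coeff l) * s ^ (l : ℕ)) +
      s ^ d.natDegree := by
    rw [eval₂_eq_sum_range, Finset.sum_range_succ, hd.coeff_natDegree, map_one, one_mul,
      Finset.sum_range]
  have hv0 : d.eval₂ φ s * v (finProdFinEquiv (j, ⟨0, hm⟩)) = w j := by
    have e1 : ∑ l : Fin d.natDegree, φ (d.coeff l) * v (finProdFinEquiv (j, l)) =
        (∑ l : Fin d.natDegree, φ (d.coeff l) * s ^ (l : ℕ)) *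
          v (finProdFinEquiv (j, ⟨0, hm⟩)) := by
      rw [Finset.sum_mul]
      refine Finset.sum_congr rfl fun l _ => ?_
      rw [hpow l l.isLt, mul_assoc]
    have e2 : s ^ d.natDegree = s * s ^ (d.natDegree - 1) := by
      rw [← pow_succ', hl]
    rw [hev, add_mul, ← e1, e2]
    linear_combination hlast
  rw [hpow i i.isLt, ← hv0]
  field_simp

theorem controllableForm_output (hd : d.Monic) (hQ : ∀ k j, (Q k j).degree < d.degree) {s : K}
    (hs : d.eval₂ φ s ≠ 0) {v : Fin (n * d.natDegree) → K} {w : Fin n → K}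
    (h : s • v = ((controllableForm d Q D).A.map φ).mulVec v +
      ((controllableForm d Q D).B.map φ).mulVec w) :
    ((controllableForm d Q D).C.map φ).mulVec v + (D.map φ).mulVec w =
      (Matrix.of fun k j => (Q k j).eval₂ φ s / d.eval₂ φ s + φ (D k j)).mulVec w := by
  ext k
  rw [Pi.add_apply, controllableForm_C_mulVec]
  simp only [Matrix.mulVec, dotProduct, Matrix.map_apply, Matrix.of_apply]
  rw [← Finset.sum_add_distrib]
  refine Finset.sum_congr rfl fun j _ => ?_
  have hev : (Q k j).eval₂ φ s = ∑ l : Fin d.natDegree, φ ((Q k j).coeff l) * s ^ (l : ℕ) := by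
    rw [eval₂_eq_sum, ← Polynomial.sum_fin (fun e a => φ a * s ^ e) (by simp) ?_]
    rw [← degree_eq_natDegree hd.ne_zero]
    exact hQ k j
  simp only [controllableForm_state φ hd hs h, ← mul_assoc]
  rw [← Finset.sum_mul, ← hev, add_mul]
  congr 1
  ring

theorem eval₂_C_X_ratFunc (q : ℝ[X]) :
    q.eval₂ (RatFunc.C : ℝ →+* RatFunc ℝ) RatFunc.X = algebraMap ℝ[X] (RatFunc ℝ) q := by
  have h := hom_eval₂ q (C : ℝ →+* ℝ[X]) (algebraMap ℝ[X] (RatFunc ℝ)) X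
  rw [eval₂_C_X, RatFunc.algebraMap_X] at h
  rw [h]
  congr 1

/-- The column `(X I - A)⁻¹ B eⱼ` solves the state equation over the rational functions, so its
output is column `j` of the transfer function. -/
theorem controllableForm_transferFunction (hd : d.Monic)
    (hQ : ∀ k j, (Q k j).degree < d.degree) (k : Fin p) (j : Fin n) :
    (controllableForm d Q D).transferFunction k j =
      algebraMap ℝ[X] (RatFunc ℝ) (Q k j) / algebraMap ℝ[X] (RatFunc ℝ) d + RatFunc.C (D k j) := by
  set S := controllableForm d Q D with hS
  have hne : d.eval₂ (RatFunc.C : ℝ →+* RatFunc ℝ) RatFunc.X ≠ 0 := by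
    rw [eval₂_C_X_ratFunc]
    exact (map_ne_zero_iff _ (RatFunc.algebraMap_injective ℝ)).2 hd.ne_zero
  set w : Fin n → RatFunc ℝ := Pi.single j 1 with hw
  have h : (RatFunc.X : RatFunc ℝ) • (resolventMatrix S.A).mulVec ((S.B.map RatFunc.C).mulVec w) =
      (S.A.map RatFunc.C).mulVec ((resolventMatrix S.A).mulVec ((S.B.map RatFunc.C).mulVec w)) +
        (S.B.map RatFunc.C).mulVec w := by
    rw [← Matrix.smul_mulVec, X_smul_resolventMatrix, Matrix.add_mulVec, Matrix.one_mulVec,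
      ← Matrix.mulVec_mulVec, add_comm]
  have h2 := congrFun (controllableForm_output RatFunc.C hd hQ hne h) k
  rw [Matrix.mulVec_mulVec, Matrix.mulVec_mulVec, ← Matrix.add_mulVec, hw,
    Matrix.mulVec_single_one, Matrix.mulVec_single_one] at h2
  simp only [eval₂_C_X_ratFunc, Matrix.col_apply, Matrix.of_apply] at h2
  rw [← h2]
  rfl

end Controllable

/-! ### From a common denominator to a realization of a matrix in `RH∞` -/

section Realization

open Polynomial

variable {p m : ℕ}

/-- A matrix in `RH∞` over a common denominator. -/
theorem IsRHInf.exists_common_denominator {H : Matrix (Fin p) (Fin m) (RatFunc ℝ)}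
    (hH : IsRHInf H) :
    ∃ (d : ℝ[X]) (Q : Matrix (Fin p) (Fin m) ℝ[X]) (D : Matrix (Fin p) (Fin m) ℝ),
      d.Monic ∧ (∀ s : ℂ, 0 ≤ s.re → d.eval₂ (algebraMap ℝ ℂ) s ≠ 0) ∧
      (∀ k j, (Q k j).degree < d.degree) ∧ D.map (algebraMap ℝ ℂ) = evalInfty H ∧
      ∀ k j, (H k j).num * d = (Q k j + C (D k j) * d) * (H k j).denom := by
  set d : ℝ[X] := ∏ k, ∏ j, (H k j).denom with hd
  set D : Matrix (Fin p) (Fin m) ℝ := Matrix.of fun k j =>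
    (H k j).num.coeff (H k j).denom.natDegree / (H k j).denom.leadingCoeff with hD
  have hdm : d.Monic := monic_prod_of_monic _ _ fun k _ => monic_prod_of_monic _ _ fun j _ =>
    RatFunc.monic_denom _
  have hdvd : ∀ k j, ∃ q, d = (H k j).denom * q := fun k j =>
    (Finset.dvd_prod_of_mem (fun j => (H k j).denom) (Finset.mem_univ j)).trans
      (Finset.dvd_prod_of_mem (fun k => ∏ j, (H k j).denom) (Finset.mem_univ k))
  choose q hq using hdvd
  refine ⟨d, Matrix.of fun k j => (H k j).num * q k j - C (D k j) * d, D, hdm, ?_, ?_, ?_, ?_⟩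
  · intro s hs
    rw [hd, eval₂_finsetProd, Finset.prod_ne_zero_iff]
    intro k _
    rw [eval₂_finsetProd, Finset.prod_ne_zero_iff]
    exact fun j _ => (hH k j).2 s hs
  · intro k j
    have hqm : (q k j).Monic := (RatFunc.monic_denom (H k j)).of_mul_monic_left (hq k j ▸ hdm)
    have hdeg : d.natDegree = (H k j).denom.natDegree + (q k j).natDegree := by
      conv_lhs => rw [hq k j]
      exact (RatFunc.monic_denom _).natDegree_mul hqm
    rw [Matrix.of_apply, degree_eq_natDegree hdm.ne_zero, degree_lt_iff_coeff_zero]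
    intro i hi
    rw [coeff_sub, coeff_C_mul]
    -- Only the coefficient at the degree of `d` needs an argument: there the choice of `D` as the
    -- value at infinity cancels the two contributions.
    rcases hi.eq_or_lt with rfl | hi
    · rw [hdm.coeff_natDegree, hdeg, coeff_mul_add_eq_of_natDegree_le (hH k j).1 le_rfl,
        hqm.coeff_natDegree]
      simp [hD, (RatFunc.monic_denom (H k j)).leadingCoeff]
    · rw [coeff_eq_zero_of_natDegree_lt hi, mul_zero, sub_zero]
      refine coeff_eq_zero_of_natDegree_lt (lt_of_le_of_lt natDegree_mul_le ?_)
      have := (hH k j).1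
      omega
  · ext k j
    rfl
  · intro k j
    rw [Matrix.of_apply, sub_add_cancel]
    conv_lhs => rw [hq k j]
    ring

/-- A matrix in `RH∞` has a realization without unstable modes. -/
theorem IsRHInf.exists_realization {H : Matrix (Fin p) (Fin m) (RatFunc ℝ)} (hH : IsRHInf H) :
    ∃ (N : ℕ) (S : StateSpace N m p), S.transferFunction = H ∧
      S.D.map (algebraMap ℝ ℂ) = evalInfty H ∧
      ∀ s : ℂ, 0 ≤ s.re → ∀ v w, s • v = (S.A.map (algebraMap ℝ ℂ)).mulVec v +
          (S.B.map (algebraMap ℝ ℂ)).mulVec w →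
        (S.C.map (algebraMap ℝ ℂ)).mulVec v + (S.D.map (algebraMap ℝ ℂ)).mulVec w =
          (evalAt H s).mulVec w ∧ (w = 0 → v = 0) := by
  obtain ⟨d, Q, D, hd, hs, hQ, hD, hnum⟩ := hH.exists_common_denominator
  refine ⟨_, controllableForm d Q D, ?_, hD, fun s hs0 v w h => ⟨?_, ?_⟩⟩
  · ext k j
    rw [controllableForm_transferFunction hd hQ, ← RatFunc.num_div_denom (H k j)]
    have h1 : algebraMap ℝ[X] (RatFunc ℝ) d ≠ 0 :=
      (map_ne_zero_iff _ (RatFunc.algebraMap_injective ℝ)).2 hd.ne_zero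
    have h2 : algebraMap ℝ[X] (RatFunc ℝ) (H k j).denom ≠ 0 :=
      (map_ne_zero_iff _ (RatFunc.algebraMap_injective ℝ)).2 (RatFunc.denom_ne_zero _)
    have h3 := congrArg (algebraMap ℝ[X] (RatFunc ℝ)) (hnum k j)
    simp only [map_mul, map_add, RatFunc.algebraMap_C] at h3
    rw [div_add' _ _ _ h1, div_eq_div_iff h1 h2, ← h3]
  · refine (controllableForm_output (algebraMap ℝ ℂ) hd hQ (hs s hs0) h).trans ?_
    congr 1
    ext k j
    have h2 : (H k j).denom.eval₂ (algebraMap ℝ ℂ) s ≠ 0 := (hH k j).2 s hs0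
    have h3 := congrArg (eval₂ (algebraMap ℝ ℂ) s) (hnum k j)
    simp only [eval₂_mul, eval₂_add, eval₂_C] at h3
    rw [Matrix.of_apply, evalAt, Matrix.map_apply, RatFunc.eval, div_add' _ _ _ (hs s hs0),
      div_eq_div_iff (hs s hs0) h2, ← h3]
  · rintro rfl
    ext a
    obtain ⟨⟨j, i⟩, rfl⟩ := finProdFinEquiv.surjective a
    rw [controllableForm_state (algebraMap ℝ ℂ) hd (hs s hs0) h]
    simp

end Realization

end

section

open Set

/-! ### Homotopies of stable matrices -/

open Polynomial in
-- Every root `r` satisfies `Re r < 0`, so each factor obeys `|s - r| ≥ Re s`. Unlike nonvanishing,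
-- this lower bound does not depend on the matrix and survives limits.
theorem pow_re_le_norm_eval_charpoly {N : ℕ} {M : Matrix (Fin N) (Fin N) ℂ}
    (hM : ∀ s : ℂ, 0 ≤ s.re → M.charpoly.eval s ≠ 0) {s : ℂ} (hs : 0 < s.re) :
    s.re ^ N ≤ ‖M.charpoly.eval s‖ := by
  have hsp := IsAlgClosed.splits M.charpoly
  have hcard : M.charpoly.roots.card = N := by
    rw [← hsp.natDegree_eq_card_roots, Matrix.charpoly_natDegree_eq_dim, Fintype.card_fin]
  have key : ∀ t : Multiset ℂ, (∀ r ∈ t, r.re < 0) →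
      s.re ^ t.card ≤ ‖((t.map fun r => X - C r).prod).eval s‖ := by
    intro t
    induction t using Multiset.induction with
    | empty => simp
    | cons r t ih =>
      intro ht
      have h1 := ih fun a ha => ht a (Multiset.mem_cons_of_mem ha)
      have h2 : s.re ≤ ‖s - r‖ := by
        have := Complex.re_le_norm (s - r)
        have := ht r (Multiset.mem_cons_self r t)
        rw [Complex.sub_re] at *
        linarith
      rw [Multiset.card_cons, pow_succ', Multiset.map_cons, Multiset.prod_cons, eval_mul, norm_mul]
      simp only [eval_sub, eval_X, eval_C]
      gcongr
  have h := key M.charpoly.roots fun r hr => by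
    by_contra! hr0
    exact hM r hr0 (isRoot_of_mem_roots hr)
  rw [hcard] at h
  rwa [hsp.eq_prod_roots_of_monic M.charpoly_monic]

theorem exists_eigenvector {N : ℕ} {M : Matrix (Fin N) (Fin N) ℂ} {s : ℂ}
    (h : M.charpoly.eval s = 0) : ∃ v, v ≠ 0 ∧ s • v = M.mulVec v := by
  rw [Matrix.eval_charpoly, ← Matrix.exists_mulVec_eq_zero_iff] at h
  obtain ⟨v, hv, hv'⟩ := h
  refine ⟨v, hv, ?_⟩
  rw [Matrix.sub_mulVec, sub_eq_zero] at hv'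
  rw [← hv']
  ext i
  simp [Matrix.scalar_apply, Matrix.mulVec_diagonal]

open scoped Matrix.Norms.Operator in
/-- Along a path of matrices that starts at a stable matrix and never has an imaginary eigenvalue,
all matrices are stable. -/
theorem hurwitz_of_homotopy {N : ℕ} {M : ℝ → Matrix (Fin N) (Fin N) ℂ}
    (hM : ContinuousOn M (Icc 0 1))
    (h0 : ∀ s : ℂ, 0 ≤ s.re → (M 0).charpoly.eval s ≠ 0)
    (him : ∀ τ ∈ Icc (0 : ℝ) 1, ∀ s : ℂ, s.re = 0 → (M τ).charpoly.eval s ≠ 0) {s : ℂ}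
    (hs : 0 ≤ s.re) : (M 1).charpoly.eval s ≠ 0 := by
  set f : ℝ × ℂ → ℂ := fun q => (M q.1).charpoly.eval q.2 with hf
  have hfc : ContinuousOn f (Icc 0 1 ×ˢ univ) := by
    simp only [hf, Matrix.eval_charpoly]
    have hdet : Continuous fun A : Matrix (Fin N) (Fin N) ℂ => A.det :=
      Continuous.matrix_det continuous_id
    refine hdet.comp_continuousOn (ContinuousOn.sub ?_ (hM.comp continuousOn_fst fun q hq => hq.1))
    simp only [Matrix.scalar_apply]
    exact (Continuous.matrix_diagonal (by fun_prop)).continuousOn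
  obtain ⟨R, hR⟩ := isCompact_Icc.exists_bound_of_continuousOn hM
  -- Two closed sets of parameters cover `[0, 1]`: those satisfying the uniform lower bound, and
  -- those having a root in the closed right half plane. The second is closed as the projection of a
  -- compact set, since eigenvalues are bounded by the norm of the matrix.
  set S : Set ℝ := ⋂ s : {s : ℂ // 0 < s.re},
    {τ ∈ Icc (0 : ℝ) 1 | s.1.re ^ N ≤ ‖f (τ, s.1)‖} with hS
  set K : Set (ℝ × ℂ) := {q ∈ Icc (0 : ℝ) 1 ×ˢ univ | 0 ≤ q.2.re ∧ f q = 0} with hK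
  have hSc : IsClosed S := by
    refine isClosed_iInter fun s => ?_
    have hc : ContinuousOn (fun τ => ‖f (τ, s.1)‖) (Icc 0 1) :=
      (hfc.comp (by fun_prop) fun τ hτ => ⟨hτ, trivial⟩).norm
    exact hc.preimage_isClosed_of_isClosed isClosed_Icc isClosed_Ici
  have hKc : IsCompact K := by
    refine ((isCompact_Icc (a := (0 : ℝ)) (b := 1)).prod
      (isCompact_closedBall (0 : ℂ) R)).of_isClosed_subset ?_ ?_
    · have h1 : IsClosed (Icc (0 : ℝ) 1 ×ˢ (univ : Set ℂ)) := isClosed_Icc.prod isClosed_univ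
      have h2 := hfc.preimage_isClosed_of_isClosed h1 (isClosed_singleton (x := (0 : ℂ)))
      have h3 : IsClosed {q : ℝ × ℂ | 0 ≤ q.2.re} :=
        isClosed_le continuous_const (by fun_prop)
      convert h2.inter h3 using 1
      ext q
      simp only [hK, mem_ofPred_eq, mem_inter_iff, mem_preimage, mem_singleton_iff]
      tauto
    · rintro ⟨τ, s⟩ ⟨⟨hτ, -⟩, -, hq⟩
      refine ⟨hτ, ?_⟩
      obtain ⟨v, hv, hv'⟩ := exists_eigenvector hq
      have h1 : ‖s‖ * ‖v‖ ≤ ‖M τ‖ * ‖v‖ := by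
        rw [← norm_smul, hv']
        exact Matrix.linfty_opNorm_mulVec _ _
      rw [mem_closedBall_zero_iff]
      exact (le_of_mul_le_mul_right h1 (norm_pos_iff.2 hv)).trans (hR τ hτ)
  have hUc : IsClosed (Prod.fst '' K) := (hKc.image continuous_fst).isClosed
  have hcover : Icc (0 : ℝ) 1 ⊆ S ∪ Prod.fst '' K := by
    intro τ hτ
    by_cases hU : τ ∈ Prod.fst '' K
    · exact Or.inr hU
    · refine Or.inl (mem_iInter.2 fun s => ⟨hτ, pow_re_le_norm_eval_charpoly ?_ s.2⟩)
      exact fun z hz hz0 => hU ⟨(τ, z), ⟨⟨hτ, trivial⟩, hz, hz0⟩, rfl⟩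
  intro hs0
  have h1U : (1 : ℝ) ∈ Prod.fst '' K := ⟨(1, s), ⟨⟨⟨zero_le_one, le_rfl⟩, trivial⟩, hs, hs0⟩, rfl⟩
  have h0S : (0 : ℝ) ∈ S := mem_iInter.2 fun s =>
    ⟨⟨le_rfl, zero_le_one⟩, pow_re_le_norm_eval_charpoly h0 s.2⟩
  -- By connectedness the two sets meet. At a common parameter a root with positive real part
  -- violates the lower bound, and one on the imaginary axis is excluded by `him`.
  obtain ⟨τ, hτ, hτS, ⟨q, hq, rfl⟩⟩ := isPreconnected_closed_iff.1 isPreconnected_Icc S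
    (Prod.fst '' K) hSc hUc hcover ⟨0, ⟨le_rfl, zero_le_one⟩, h0S⟩ ⟨1, ⟨zero_le_one, le_rfl⟩, h1U⟩
  obtain ⟨-, hq1, hq2⟩ := hq
  rcases hq1.eq_or_lt with hre | hre
  · exact him q.1 hτ q.2 hre.symm hq2
  · have := (mem_iInter.1 hτS ⟨q.2, hre⟩).2
    rw [show f (q.1, q.2) = 0 from hq2, norm_zero] at this
    exact absurd this (not_le.2 (pow_pos hre N))

/-! ### Real negative eigenvalues and the scaled relative graph -/

/-- The normalized `w` is an eigenvector for `-1/τ`; input and output are antiparallel, so the angle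
is `π` and the modulus is `1/τ`. -/
theorem neg_one_mem_smul_SRG {n : ℕ} {A : Matrix (Fin n) (Fin n) ℂ} {w : Fin n → ℂ} (hw : w ≠ 0)
    {τ : ℝ} (hτ : 0 < τ) (h : w + (τ : ℂ) • A.mulVec w = 0) : (-1 : ℂ) ∈ τ • SRG A := by
  set x : EuclideanSpace ℂ (Fin n) := WithLp.toLp 2 w with hx
  have hx0 : x ≠ 0 := fun h0 => hw (by simpa [hx] using h0)
  set u : EuclideanSpace ℂ (Fin n) := ((‖x‖⁻¹ : ℝ) : ℂ) • x with hu
  have hτc : (τ : ℂ) ≠ 0 := by exact_mod_cast hτ.ne'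
  have hAw : A.mulVec w = (-(τ⁻¹ : ℝ) : ℂ) • w := by
    have : (τ : ℂ) • A.mulVec w = -w := by rw [← add_eq_zero_iff_eq_neg, add_comm]; exact h
    rw [← inv_smul_smul₀ hτc (A.mulVec w), this]
    simp
  have hun : ‖u‖ = 1 := by
    rw [hu, norm_smul, Complex.norm_real, norm_inv, norm_norm,
      inv_mul_cancel₀ (norm_ne_zero_iff.2 hx0)]
  have hu0 : u ≠ 0 := fun h0 => by simp [h0] at hun
  have hy : (WithLp.toLp 2 (A.mulVec u.ofLp) : EuclideanSpace ℂ (Fin n)) =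
      (-(τ⁻¹ : ℝ) : ℂ) • u := by
    rw [hu, WithLp.ofLp_smul, Matrix.mulVec_smul, hx, hAw, smul_comm]
    rfl
  have hyn : ‖(-(τ⁻¹ : ℝ) : ℂ) • u‖ = τ⁻¹ := by
    rw [norm_smul, hun, mul_one, norm_neg, Complex.norm_real, Real.norm_of_nonneg (by positivity)]
  have hy0 : (-(τ⁻¹ : ℝ) : ℂ) • u ≠ 0 := by
    rw [← norm_ne_zero_iff, hyn]; positivity
  have hang : vecAngle u ((-(τ⁻¹ : ℝ) : ℂ) • u) = Real.pi := by
    rw [vecAngle, if_neg (by tauto), hyn, hun, inner_smul_left, inner_self_eq_norm_sq_to_K, hun]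
    rw [← Real.arccos_neg_one]
    congr 1
    simp [hτ.ne']
  refine Set.mem_smul_set.2 ⟨(-(τ⁻¹ : ℝ) : ℂ), ⟨u, _, hun, hy.symm, Or.inl ?_⟩, ?_⟩
  · rw [hang, hyn, hun, mul_comm Complex.I, Complex.exp_pi_mul_I]
    simp
  · rw [Complex.real_smul]
    push_cast
    field_simp

/-! ### Stability of the closed loop matrix -/

section ClosedLoop

variable {N n : ℕ}

/-- The state matrix of the feedback loop `e = -τ y`. -/
def StateSpace.closedLoop (S : StateSpace N n n) (τ : ℝ) : Matrix (Fin N) (Fin N) ℝ :=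
  S.A - τ • (S.B * (1 + τ • S.D)⁻¹ * S.C)

theorem StateSpace.continuousOn_closedLoop {S : StateSpace N n n} {T : Set ℝ}
    (hdet : ∀ τ ∈ T, (1 + τ • S.D).det ≠ 0) :
    ContinuousOn (fun τ => (S.closedLoop τ).map (algebraMap ℝ ℂ)) T := by
  have h1 : Continuous fun τ : ℝ => (1 + τ • S.D : Matrix (Fin n) (Fin n) ℝ) := by fun_prop
  have h2 : ContinuousOn (fun τ : ℝ => (1 + τ • S.D)⁻¹) T := by
    simp only [Matrix.inv_def, Ring.inverse_eq_inv']
    exact (h1.matrix_det.continuousOn.inv₀ hdet).smul h1.matrix_adjugate.continuousOn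
  have h3 : Continuous fun G : Matrix (Fin n) (Fin n) ℝ => S.B * G * S.C := by fun_prop
  have h4 : ContinuousOn S.closedLoop T :=
    continuousOn_const.sub (continuousOn_id.smul (h3.comp_continuousOn h2))
  have h5 : Continuous fun A : Matrix (Fin N) (Fin N) ℝ => A.map (algebraMap ℝ ℂ) :=
    Continuous.matrix_map continuous_id Complex.continuous_ofReal
  exact h5.comp_continuousOn h4

/-- The witness is the error signal in the loop, `w = -τ (I + τ D)⁻¹ C v`. With it the eigenvector
equation becomes the open-loop state equation driven by `w`, and `w = -τ y` with `y = H(s) w`. It is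
nonzero because the realization has no mode at `s` without input. -/
theorem StateSpace.exists_of_closedLoop_eigenvalue {S : StateSpace N n n}
    {H : Matrix (Fin n) (Fin n) (RatFunc ℝ)} {τ : ℝ} (hdet : (1 + τ • S.D).det ≠ 0) {s : ℂ}
    (hH : ∀ v w, s • v = (S.A.map (algebraMap ℝ ℂ)).mulVec v +
          (S.B.map (algebraMap ℝ ℂ)).mulVec w →
        (S.C.map (algebraMap ℝ ℂ)).mulVec v + (S.D.map (algebraMap ℝ ℂ)).mulVec w =
          (evalAt H s).mulVec w ∧ (w = 0 → v = 0))
    (hs : ((S.closedLoop τ).map (algebraMap ℝ ℂ)).charpoly.eval s = 0) :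
    ∃ w : Fin n → ℂ, w ≠ 0 ∧ w + (τ : ℂ) • (evalAt H s).mulVec w = 0 := by
  obtain ⟨v, hv, hsv⟩ := exists_eigenvector hs
  set G : Matrix (Fin n) (Fin n) ℝ := (1 + τ • S.D)⁻¹ with hG
  have hDG : (1 + τ • S.D) * G = 1 := Matrix.mul_nonsing_inv _ hdet.isUnit
  have hsm : ∀ {p q : ℕ} (M : Matrix (Fin p) (Fin q) ℝ),
      (τ • M).map (algebraMap ℝ ℂ) = (τ : ℂ) • M.map (algebraMap ℝ ℂ) := fun M => by
    ext i j; simp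
  have hDGc : (1 + (τ : ℂ) • S.D.map (algebraMap ℝ ℂ)) * G.map (algebraMap ℝ ℂ) = 1 := by
    rw [← hsm, ← Matrix.map_one (n := Fin n) (algebraMap ℝ ℂ) (map_zero _) (map_one _),
      ← Matrix.map_add _ (map_add _), ← Matrix.map_mul, hDG]
  set w : Fin n → ℂ := (-(τ : ℂ)) • (G.map (algebraMap ℝ ℂ)).mulVec
    ((S.C.map (algebraMap ℝ ℂ)).mulVec v) with hw
  have h1 : s • v = (S.A.map (algebraMap ℝ ℂ)).mulVec v +
      (S.B.map (algebraMap ℝ ℂ)).mulVec w := by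
    rw [hsv, StateSpace.closedLoop, Matrix.map_sub _ (map_sub _), hsm, Matrix.map_mul,
      Matrix.map_mul, Matrix.sub_mulVec, hw, Matrix.mulVec_smul, Matrix.mulVec_mulVec,
      Matrix.mulVec_mulVec, Matrix.smul_mulVec, neg_smul, sub_eq_add_neg, ← hG, Matrix.mul_assoc]
  obtain ⟨h2, h3⟩ := hH v w h1
  refine ⟨w, fun h0 => hv (h3 h0), ?_⟩
  have h4 : w + (τ : ℂ) • (S.D.map (algebraMap ℝ ℂ)).mulVec w =
      (-(τ : ℂ)) • (S.C.map (algebraMap ℝ ℂ)).mulVec v := by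
    have : w + (τ : ℂ) • (S.D.map (algebraMap ℝ ℂ)).mulVec w =
        (1 + (τ : ℂ) • S.D.map (algebraMap ℝ ℂ)).mulVec w := by
      rw [Matrix.add_mulVec, Matrix.one_mulVec, Matrix.smul_mulVec]
    rw [this, hw, Matrix.mulVec_smul, Matrix.mulVec_mulVec, hDGc, Matrix.one_mulVec]
  rw [← h2, smul_add, add_left_comm, h4]
  simp

/-- Under the graphical condition, the loop is well posed and its state matrix is stable. -/
theorem StateSpace.closedLoop_hurwitz {S : StateSpace N n n}
    {H : Matrix (Fin n) (Fin n) (RatFunc ℝ)}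
    (hD : S.D.map (algebraMap ℝ ℂ) = evalInfty H)
    (hS : ∀ s : ℂ, 0 ≤ s.re → ∀ v w, s • v = (S.A.map (algebraMap ℝ ℂ)).mulVec v +
          (S.B.map (algebraMap ℝ ℂ)).mulVec w →
        (S.C.map (algebraMap ℝ ℂ)).mulVec v + (S.D.map (algebraMap ℝ ℂ)).mulVec w =
          (evalAt H s).mulVec w ∧ (w = 0 → v = 0))
    (hfreq : ∀ ω : ℝ, 0 ≤ ω → ∀ τ ∈ Set.Ioc (0 : ℝ) 1,
      (-1 : ℂ) ∉ τ • SRG (evalAt H (Complex.I * (ω : ℂ))))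
    (hinfty : ∀ τ ∈ Set.Ioc (0 : ℝ) 1, (-1 : ℂ) ∉ τ • SRG (evalInfty H)) :
    (1 + S.D).det ≠ 0 ∧ ∀ s : ℂ, 0 ≤ s.re →
      ((S.closedLoop 1).map (algebraMap ℝ ℂ)).charpoly.eval s ≠ 0 := by
  have hdet : ∀ τ ∈ Icc (0 : ℝ) 1, (1 + τ • S.D).det ≠ 0 := by
    intro τ hτ h
    rcases hτ.1.eq_or_lt with rfl | hτ0
    · simp at h
    have hc : (1 + (τ : ℂ) • evalInfty H).det = 0 := by
      have e : (1 + (τ : ℂ) • evalInfty H) = (algebraMap ℝ ℂ).mapMatrix (1 + τ • S.D) := by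
        rw [← hD, map_add, map_one]
        congr 1
        ext i j
        simp
      rw [e, ← RingHom.map_det, h, map_zero]
    obtain ⟨w, hw, hw'⟩ := Matrix.exists_mulVec_eq_zero_iff.2 hc
    rw [Matrix.add_mulVec, Matrix.one_mulVec, Matrix.smul_mulVec] at hw'
    exact hinfty τ ⟨hτ0, hτ.2⟩ (neg_one_mem_smul_SRG hw hτ0 hw')
  refine ⟨by simpa using hdet 1 ⟨zero_le_one, le_rfl⟩, fun s hs => ?_⟩
  refine hurwitz_of_homotopy (M := fun τ => (S.closedLoop τ).map (algebraMap ℝ ℂ))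
    (StateSpace.continuousOn_closedLoop hdet) ?_ ?_ hs
  · intro s hs h
    obtain ⟨w, hw, hw'⟩ := StateSpace.exists_of_closedLoop_eigenvalue
      (hdet 0 ⟨le_rfl, zero_le_one⟩) (hS s hs) h
    simp at hw'
    exact hw hw'
  · have hup : ∀ τ ∈ Icc (0 : ℝ) 1, ∀ ω : ℝ, 0 ≤ ω →
        ((S.closedLoop τ).map (algebraMap ℝ ℂ)).charpoly.eval (Complex.I * ω) ≠ 0 := by
      intro τ hτ ω hω h
      obtain ⟨w, hw, hw'⟩ := StateSpace.exists_of_closedLoop_eigenvalue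
        (hdet τ hτ) (hS _ (by simp)) h
      rcases hτ.1.eq_or_lt with rfl | hτ0
      · simp at hw'
        exact hw hw'
      · exact hfreq ω hω τ ⟨hτ0, hτ.2⟩ (neg_one_mem_smul_SRG hw hτ0 hw')
    intro τ hτ s hs h
    have hsI : s = Complex.I * (s.im : ℂ) := by
      apply Complex.ext <;> simp [hs]
    rcases le_total 0 s.im with h0 | h0
    · rw [hsI] at h
      exact hup τ hτ _ h0 h
    · refine hup τ hτ (-s.im) (by linarith) ?_
      -- The characteristic polynomial is real, so a root at negative frequency has a conjugate root
      -- at positive frequency.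
      have hconj : Complex.I * ((-s.im : ℝ) : ℂ) = (starRingEnd ℂ) s := by
        apply Complex.ext <;> simp [hs]
      rw [Matrix.charpoly_map, Polynomial.eval_map_algebraMap] at h ⊢
      rw [hconj, Polynomial.aeval_conj, h, map_zero]

end ClosedLoop

end

section

open MeasureTheory Set

/-! ### The `L²` gain of a stable system -/

section Gain

variable {𝕜 : Type*} [RCLike 𝕜]

/-- The inclusion of real or complex vectors into complex vectors. -/
def complexify (𝕜 : Type*) [RCLike 𝕜] (n : ℕ) :
    EuclideanSpace 𝕜 (Fin n) →ₗᵢ[ℝ] EuclideanSpace ℂ (Fin n) where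
  toFun v := WithLp.toLp 2 fun i => RCLike.map 𝕜 ℂ (v i)
  map_add' v w := by ext i; simp only [PiLp.add_apply, map_add]
  map_smul' c v := by ext i; simp
  norm_map' v := by
    simp only [LinearMap.coe_mk, AddHom.coe_mk, EuclideanSpace.norm_eq]
    congr 1
    refine Finset.sum_congr rfl fun i _ => ?_
    rw [← Complex.normSq_eq_norm_sq, ← RCLike.normSq_eq_def', RCLike.normSq_apply,
      Complex.normSq_apply]
    simp [RCLike.map_apply]

theorem complexify_act {n m : ℕ} (M : Matrix (Fin n) (Fin m) ℝ) (v : EuclideanSpace 𝕜 (Fin m)) :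
    complexify 𝕜 n (act M v) = act M (complexify 𝕜 m v) := by
  ext i
  simp only [complexify, act, LinearIsometry.coe_mk, LinearMap.coe_mk, AddHom.coe_mk,
    Matrix.mulVec, dotProduct, map_sum]
  refine Finset.sum_congr rfl fun j _ => ?_
  have h := (RCLike.map 𝕜 ℂ).map_smul (M i j) (v j)
  simpa [Algebra.smul_def] using h

theorem energy_le_of_hurwitz_act {N : ℕ} {A : Matrix (Fin N) (Fin N) ℝ}
    (hA : ∀ s : ℂ, 0 ≤ s.re → (A.map (algebraMap ℝ ℂ)).charpoly.eval s ≠ 0) :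
    ∃ γ : ℝ, 0 ≤ γ ∧ ∀ f x : ℝ → EuclideanSpace 𝕜 (Fin N), LocSqInt f →
      IntegralSolution (actL A) f x → ∀ T : ℝ, 0 ≤ T →
        ∫ t in (0 : ℝ)..T, ‖x t‖ ^ 2 ≤ γ * ∫ t in (0 : ℝ)..T, ‖f t‖ ^ 2 := by
  obtain ⟨γ, hγ, h⟩ := energy_le_of_hurwitz (A.map (algebraMap ℝ ℂ)) fun s hs => by
    by_contra! hs0
    exact hA s hs0 hs
  refine ⟨γ, hγ, fun f x hf hx T hT => ?_⟩
  have hz := hx.map hf.locInt (A' := (Matrix.toEuclideanCLM (𝕜 := ℂ)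
    (A.map (algebraMap ℝ ℂ))).restrictScalars ℝ) (complexify 𝕜 N).toContinuousLinearMap
    fun v => complexify_act A v
  have := h _ _ (hf.map (complexify 𝕜 N).toContinuousLinearMap) hz T hT
  simpa using this

theorem eLpNorm_two_Icc_le {E F : Type*} [NormedAddCommGroup E] [NormedAddCommGroup F]
    {x : ℝ → E} {u : ℝ → F} (hx : LocSqInt x) (hu : LocSqInt u) {c : NNReal} {T : ℝ} (hT : 0 ≤ T)
    (h : ∫ t in (0 : ℝ)..T, ‖x t‖ ^ 2 ≤ c ^ 2 * ∫ t in (0 : ℝ)..T, ‖u t‖ ^ 2) :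
    eLpNorm x 2 (volume.restrict (Icc 0 T)) ≤ c * eLpNorm u 2 (volume.restrict (Icc 0 T)) := by
  rw [(hx T hT).eLpNorm_eq_integral_rpow_norm two_ne_zero ENNReal.ofNat_ne_top,
    (hu T hT).eLpNorm_eq_integral_rpow_norm two_ne_zero ENNReal.ofNat_ne_top,
    ← ENNReal.ofReal_coe_nnreal, ← ENNReal.ofReal_mul c.coe_nonneg]
  refine ENNReal.ofReal_le_ofReal ?_
  simp only [ENNReal.toReal_ofNat, Real.rpow_ofNat]
  rw [intervalIntegral.integral_of_le hT, intervalIntegral.integral_of_le hT,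
    ← integral_Icc_eq_integral_Ioc, ← integral_Icc_eq_integral_Ioc] at h
  have e : ∀ a : ℝ, a ^ (2 : ℝ)⁻¹ = √a := fun a => by rw [Real.sqrt_eq_rpow]; norm_num
  rw [e, e]
  calc _ ≤ √(c ^ 2 * ∫ t in Icc 0 T, ‖u t‖ ^ 2) := Real.sqrt_le_sqrt h
    _ = _ := by rw [Real.sqrt_mul (by positivity), Real.sqrt_sq c.coe_nonneg]

theorem eLpNorm_two_le_of_forall_Icc {E F : Type*} [NormedAddCommGroup E] [NormedAddCommGroup F]
    {x : ℝ → E} {u : ℝ → F} (hx : LocSqInt x) (hu : LocSqInt u)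
    (hxm : AEStronglyMeasurable x timeMeasure) {c : NNReal}
    (h : ∀ T : ℝ, 0 ≤ T →
      ∫ t in (0 : ℝ)..T, ‖x t‖ ^ 2 ≤ c ^ 2 * ∫ t in (0 : ℝ)..T, ‖u t‖ ^ 2) :
    eLpNorm x 2 timeMeasure ≤ c * eLpNorm u 2 timeMeasure := by
  -- Fatou's lemma for the truncations of `x` to `[0, k]`. The finiteness of the norm of `x` is a
  -- conclusion here.
  have hlim := Lp.eLpNorm_lim_le_liminf_eLpNorm (p := 2) (μ := timeMeasure)
    (f := fun k : ℕ => (Icc (0 : ℝ) k).indicator x) (fun k => hxm.indicator measurableSet_Icc) x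
    (by
      filter_upwards [ae_restrict_mem measurableSet_Ici] with t ht
      obtain ⟨k, hk⟩ := exists_nat_ge t
      refine tendsto_const_nhds.congr' ?_
      filter_upwards [Filter.eventually_ge_atTop k] with l hl
      rw [indicator_of_mem]
      exact ⟨ht, hk.trans (by exact_mod_cast hl)⟩)
  have hbound : ∀ k : ℕ, eLpNorm ((Icc (0 : ℝ) k).indicator x) 2 timeMeasure ≤
      c * eLpNorm u 2 timeMeasure := by
    intro k
    have hk : (0 : ℝ) ≤ k := Nat.cast_nonneg k
    have hmono : (volume.restrict (Icc (0 : ℝ) k)) ≤ timeMeasure :=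
      Measure.restrict_mono_set volume Icc_subset_Ici_self
    rw [eLpNorm_indicator_eq_eLpNorm_restrict measurableSet_Icc,
      Measure.restrict_restrict measurableSet_Icc,
      inter_eq_self_of_subset_left (Icc_subset_Ici_self)]
    exact (eLpNorm_two_Icc_le hx hu hk (h k hk)).trans
      (mul_le_mul_of_nonneg_left (eLpNorm_mono_measure u hmono) zero_le)
  exact hlim.trans (Filter.liminf_le_of_frequently_le'
    (Filter.Eventually.of_forall hbound).frequently)

end Gain

/-! ### The feedback loop -/

section Loop

variable {𝕜 : Type*} [RCLike 𝕜] {n N : ℕ}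

/-- The output of the feedback loop in terms of its state and its input. -/
def StateSpace.loopOutput (S : StateSpace N n n) (x : Signal 𝕜 N) (u : Signal 𝕜 n) :
    Signal 𝕜 n :=
  fun t => act ((1 + S.D)⁻¹ * S.C) (x t) + act ((1 + S.D)⁻¹ * S.D) (u t)

/-- The direct feedthrough makes the loop an algebraic equation for `y`, namely `(I + D) y = C x + D
u`. -/
theorem eq_loop_iff {S : StateSpace N n n} (hdet : (1 + S.D).det ≠ 0)
    (x : EuclideanSpace 𝕜 (Fin N)) (u y : EuclideanSpace 𝕜 (Fin n)) :
    y = act S.C x + act S.D (u - y) ↔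
      y = act ((1 + S.D)⁻¹ * S.C) x + act ((1 + S.D)⁻¹ * S.D) u := by
  have h1 : (1 + S.D)⁻¹ * (1 + S.D) = 1 := Matrix.nonsing_inv_mul _ hdet.isUnit
  have h2 : (1 + S.D) * (1 + S.D)⁻¹ = 1 := Matrix.mul_nonsing_inv _ hdet.isUnit
  have e1 : y = act S.C x + act S.D (u - y) ↔ act (1 + S.D) y = act S.C x + act S.D u := by
    rw [act_sub, act_add_left, act_one, ← add_sub_assoc, eq_sub_iff_add_eq]
  rw [e1, act_mul, act_mul, ← act_add]
  constructor
  · intro h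
    rw [← h, ← act_mul, h1, act_one]
  · intro h
    rw [h, ← act_mul, h2, act_one]

theorem loop_field {S : StateSpace N n n} (hdet : (1 + S.D).det ≠ 0)
    {x : EuclideanSpace 𝕜 (Fin N)} {u y : EuclideanSpace 𝕜 (Fin n)}
    (h : y = act ((1 + S.D)⁻¹ * S.C) x + act ((1 + S.D)⁻¹ * S.D) u) :
    act S.A x + act S.B (u - y) = act (S.closedLoop 1) x + act (S.B * (1 + S.D)⁻¹) u := by
  have h1 : (1 + S.D)⁻¹ * (1 + S.D) = 1 := Matrix.nonsing_inv_mul _ hdet.isUnit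
  have h2 : u - y = act (1 + S.D)⁻¹ u - act ((1 + S.D)⁻¹ * S.C) x := by
    have h3 : u = act (1 + S.D)⁻¹ u + act ((1 + S.D)⁻¹ * S.D) u := by
      conv_lhs => rw [← act_one u, ← h1, mul_add, mul_one, act_add_left]
    rw [h]
    nth_rewrite 1 [h3]
    abel
  rw [h2, StateSpace.closedLoop, one_smul, one_smul, act_sub_left, act_sub, act_mul S.B, act_mul,
    Matrix.mul_assoc, act_mul S.B, act_mul]
  abel

theorem exists_unityFeedback {S : StateSpace N n n} (hdet : (1 + S.D).det ≠ 0) {u : Signal 𝕜 n}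
    (hu : MemL2e u) :
    ∃ y : Signal 𝕜 n, MemL2e y ∧ UnityFeedback S.transferFunction u y := by
  have hf := hu.locSqInt.map (actL (𝕜 := 𝕜) (S.B * (1 + S.D)⁻¹))
  obtain ⟨x, hx⟩ := exists_integralSolution (actL (𝕜 := 𝕜) (S.closedLoop 1)) hf.locInt
  have hy : LocSqInt (S.loopOutput x u) :=
    (hx.cont.locSqInt.map (actL ((1 + S.D)⁻¹ * S.C))).add
      (hu.locSqInt.map (actL ((1 + S.D)⁻¹ * S.D)))
  refine ⟨S.loopOutput x u, hy.memL2e, N, S, rfl, (hu.locSqInt.sub hy).memL2e, x, hx.cont, ?_, ?_⟩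
  · intro t ht
    rw [hx.eq t ht]
    refine intervalIntegral.integral_congr fun s _ => ?_
    exact (loop_field hdet rfl).symm
  · exact Filter.Eventually.of_forall fun t => (eq_loop_iff hdet _ _ _).2 rfl

/-- The given output may come from another realization of the same transfer function. Driving `S`
with the same error `u - y` yields the same output almost everywhere, and eliminating `y` turns the
state equation of `S` into the closed-loop one. -/
theorem UnityFeedback.exists_state {S : StateSpace N n n} (hdet : (1 + S.D).det ≠ 0)
    {u y : Signal 𝕜 n} (h : UnityFeedback S.transferFunction u y) :
    ∃ x : Signal 𝕜 N, IntegralSolution (actL (S.closedLoop 1))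
      (fun t => actL (S.B * (1 + S.D)⁻¹) (u t)) x ∧ y =ᵐ[timeMeasure] S.loopOutput x u := by
  obtain ⟨N', S', hS', hy⟩ := h
  have he := hy.1
  obtain ⟨x, hx⟩ := exists_integralSolution (actL (𝕜 := 𝕜) S.A)
    (he.locSqInt.map (actL (𝕜 := 𝕜) S.B)).locInt
  have hresp : S.IsResponse (fun t => u t - y t)
      (fun t => act S.C (x t) + act S.D (u t - y t)) :=
    ⟨he, x, hx.cont, hx.eq, Filter.Eventually.of_forall fun t => rfl⟩
  have hae : y =ᵐ[timeMeasure] S.loopOutput x u := by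
    filter_upwards [hy.ae_eq hS' hresp] with t ht
    exact (eq_loop_iff hdet _ _ _).1 ht
  refine ⟨x, ⟨hx.cont, fun t ht => ?_⟩, hae⟩
  rw [hx.eq t ht]
  refine intervalIntegral.integral_congr_ae ?_
  filter_upwards [(ae_restrict_iff' measurableSet_Ici).1 hae] with s hs hst
  rw [uIoc_of_le ht] at hst
  exact loop_field hdet (hs hst.1.le)

theorem eLpNorm_actL_le {p m : ℕ} (M : Matrix (Fin p) (Fin m) ℝ) (u : Signal 𝕜 m) :
    eLpNorm (fun t => act M (u t)) 2 timeMeasure ≤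
      ‖actL (𝕜 := 𝕜) M‖₊ * eLpNorm u 2 timeMeasure := by
  have := eLpNorm_le_nnreal_smul_eLpNorm_of_ae_le_mul (μ := timeMeasure)
    (Filter.Eventually.of_forall fun t => (actL (𝕜 := 𝕜) M).le_opNNNorm (u t)) 2
  rwa [ENNReal.smul_def, smul_eq_mul] at this

theorem exists_gain {S : StateSpace N n n} (hdet : (1 + S.D).det ≠ 0)
    (hA : ∀ s : ℂ, 0 ≤ s.re → ((S.closedLoop 1).map (algebraMap ℝ ℂ)).charpoly.eval s ≠ 0) :
    ∃ γ : NNReal, ∀ u y : Signal 𝕜 n, MemL2 u → UnityFeedback S.transferFunction u y →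
      MemL2 y ∧ l2norm y ≤ γ * l2norm u := by
  obtain ⟨γ, hγ, h⟩ := energy_le_of_hurwitz_act (𝕜 := 𝕜) hA
  lift γ to NNReal using hγ
  set L := actL (𝕜 := 𝕜) (S.B * (1 + S.D)⁻¹) with hL
  set c : NNReal := NNReal.sqrt γ * ‖L‖₊ with hc
  refine ⟨‖actL (𝕜 := 𝕜) ((1 + S.D)⁻¹ * S.C)‖₊ * c + ‖actL (𝕜 := 𝕜) ((1 + S.D)⁻¹ * S.D)‖₊,
    fun u y hu hy => ?_⟩
  have hul : LocSqInt u := fun T _ => hu.mono_measure (Measure.restrict_mono Icc_subset_Ici_self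
    le_rfl)
  obtain ⟨x, hx, hyx⟩ := hy.exists_state hdet
  have hxm : AEStronglyMeasurable x timeMeasure :=
    hx.cont.aestronglyMeasurable measurableSet_Ici
  have hxn : eLpNorm x 2 timeMeasure ≤ c * eLpNorm u 2 timeMeasure := by
    refine eLpNorm_two_le_of_forall_Icc hx.cont.locSqInt hul hxm fun T hT => ?_
    refine (h _ _ (hul.map L) hx T hT).trans ?_
    have hc2 : (c : ℝ) ^ 2 = γ * ‖L‖ ^ 2 := by
      rw [hc]
      push_cast
      rw [mul_pow]
      congr 1
      exact Real.sq_sqrt γ.coe_nonneg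
    rw [hc2, mul_assoc]
    exact mul_le_mul_of_nonneg_left (integral_sq_map_le hul L hT) γ.coe_nonneg
  have hx2 : MemLp x 2 timeMeasure :=
    ⟨hxm, hxn.trans_lt (ENNReal.mul_lt_top ENNReal.coe_lt_top hu.2)⟩
  have hCx : MemLp (fun t => act ((1 + S.D)⁻¹ * S.C) (x t)) 2 timeMeasure :=
    (actL (𝕜 := 𝕜) ((1 + S.D)⁻¹ * S.C)).comp_memLp' hx2
  have hDu : MemLp (fun t => act ((1 + S.D)⁻¹ * S.D) (u t)) 2 timeMeasure :=
    (actL (𝕜 := 𝕜) ((1 + S.D)⁻¹ * S.D)).comp_memLp' hu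
  refine ⟨(memLp_congr_ae hyx).2 (hCx.add hDu), ?_⟩
  rw [l2norm, l2norm, eLpNorm_congr_ae hyx]
  refine (eLpNorm_add_le hCx.1 hDu.1 (by norm_num)).trans ?_
  push_cast
  rw [add_mul, mul_assoc]
  gcongr
  · exact (eLpNorm_actL_le _ x).trans (by gcongr)
  · exact eLpNorm_actL_le _ u

end Loop

end

end SRGFeedback

end

theorem corollary1 {𝕜 : Type*} [RCLike 𝕜] (n : ℕ) (H : Matrix (Fin n) (Fin n) (RatFunc ℝ))
    (hH : SRGFeedback.IsRHInf H)
    (hfreq : ∀ ω : ℝ, 0 ≤ ω → ∀ τ ∈ Set.Ioc (0 : ℝ) 1,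
      (-1 : ℂ) ∉ τ • SRGFeedback.SRG (SRGFeedback.evalAt H (Complex.I * (ω : ℂ))))
    (hinfty : ∀ τ ∈ Set.Ioc (0 : ℝ) 1,
      (-1 : ℂ) ∉ τ • SRGFeedback.SRG (SRGFeedback.evalInfty H)) :
    SRGFeedback.IsL2Stable (SRGFeedback.UnityFeedback (𝕜 := 𝕜) H) := by
  obtain ⟨N, S, rfl, hD, hS⟩ := hH.exists_realization
  obtain ⟨hdet, hA⟩ := SRGFeedback.StateSpace.closedLoop_hurwitz hD hS hfreq hinfty
  refine ⟨fun u hu => SRGFeedback.exists_unityFeedback hdet hu, ?_,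
    SRGFeedback.exists_gain hdet hA⟩
  intro u y y' hu hy hy'
  obtain ⟨x, hx, hyx⟩ := hy.exists_state hdet
  obtain ⟨x', hx', hyx'⟩ := hy'.exists_state hdet
  filter_upwards [hyx, hyx', MeasureTheory.ae_restrict_mem measurableSet_Ici] with t h1 h2 ht
  rw [h1, h2, SRGFeedback.StateSpace.loopOutput, SRGFeedback.StateSpace.loopOutput,
    hx.unique hx' (hu.locSqInt.locInt.map _) ht]
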